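/- Let $p$ be a prime and let $K$ be a field of characteristic $0$ that is complete with respect to a discrete valuation $v$, normalized by $v(p)=1$, with valuation ring $R$, uniformizer $\pi$ and algebraically closed residue field (necessarily of characteristic $p$). Assume that $K$ contains a primitive $p$-th root of unity. Let $A=R[[t]]$, and let $f\in A$ be a principal unit (that is, $f-1$ lies in the maximal ideal of $A$) which is not a $p$-th power in $A$. Let $\mathrm{Frac}(A)[y]$ be the field extension of $\mathrm{Frac}(A)$ given by $y^p=f$, and let $B$ be the integral closure of $A$ in it. Assume that $B/\pi B$ is reduced and that $B$ is not isomorphic to $R[[s]]$ as an $R$-algebra (i.e. the rigid space with canonical formal model $\mathrm{Spf}(B)$ is not an open disk). For $0\neq g=\sum_{i\ge 0}g_it^i\in A$ put $v_\eta(g)=(\mu,m)\in\mathbb{Q}\times\mathbb{Z}$, where $\mu=\min_i v(g_i)$ and $m=\min\{i\mid v(g_i)=\mu\}$, and put $v_\eta(0)=\infty$; order $(\mathbb{Q}\times\mathbb{Z})\cup\{\infty\}$ lexicographically, with $\infty$ as largest element. Then the maximum $$(\mu,m):=\max\{\,v_\eta(f-h^p)\mid h\in A^\times\,\}$$ exists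 (and lies in $\mathbb{Q}\times\mathbb{Z}$). Furthermore: (i) $0\le\mu<p/(p-1)$ and $\mu/p\in v(K^\times)$. (ii) $m>1$ and $(m,p)=1$. (iii) For every $c\in K^\times$ with $v(c)=\mu/p$ and every $h\in A^\times$ with $v_\eta(f-h^p)=(\mu,m)$, we have $B=A[w]$, where $w:=(y-h)/c$. -/

import Mathlib

noncomputable section

namespace PCyclic

universe u

variable {K : Type u} [Field K]

/-- The valuation ring `R = {x ∈ K | 0 ≤ v x}` of an additively written valuation `v` on `K`
with values in `ℚ ∪ {∞}`. -/
abbrev valRing (v : AddValuation K (WithTop ℚ)) : ValuationSubring K :=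
  (AddValuation.toValuation v).valuationSubring

theorem mem_valRing (v : AddValuation K (WithTop ℚ)) (x : K) :
    x ∈ valRing v ↔ 0 ≤ v x := Iff.rfl

/-- The ring `A = R⟦t⟧`. -/
abbrev Disk (v : AddValuation K (WithTop ℚ)) : Type u := PowerSeries (valRing v)

/-- The `i`-th coefficient `gᵢ ∈ R` of `g = ∑ gᵢ tⁱ ∈ A`, as an element of `K`. -/
def coeffK (v : AddValuation K (WithTop ℚ)) (g : Disk v) (i : ℕ) : K :=
  ((PowerSeries.coeff i g : valRing v) : K)

open Classical in
/-- The rank-two valuation `v_η : A → (ℚ × ℤ) ∪ {∞}` (lexicographic order): if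
`g = ∑ gᵢ tⁱ ≠ 0` then `v_η g = (μ, m)` where `μ = minᵢ v(gᵢ)` and `m` is the least index `i` with
`v(gᵢ) = μ`; and `v_η 0 = ∞`. When `v` is discrete, the minimum is attained for all `g ≠ 0`. -/
def vEta (v : AddValuation K (WithTop ℚ)) (g : Disk v) : WithTop (ℚ ×ₗ ℤ) :=
  if H : ∃ i : ℕ, coeffK v g i ≠ 0 ∧ ∀ j : ℕ, v (coeffK v g i) ≤ v (coeffK v g j) then
    ((toLex ((v (coeffK v g (Nat.find H))).untopD 0, (Nat.find H : ℤ)) : ℚ ×ₗ ℤ) :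
      WithTop (ℚ ×ₗ ℤ))
  else ⊤

/-- `v_η g = (μ, m)` means that `v(g_m) = μ` is the minimal value of `v` on the coefficients of `g`
and that `m` is the first index at which it is attained. -/
theorem vEta_eq_coe_iff (v : AddValuation K (WithTop ℚ)) (g : Disk v) (μ : ℚ) (m : ℕ) :
    vEta v g = ((toLex (μ, (m : ℤ)) : ℚ ×ₗ ℤ) : WithTop (ℚ ×ₗ ℤ)) ↔
      v (coeffK v g m) = (μ : WithTop ℚ) ∧ (∀ j, (μ : WithTop ℚ) ≤ v (coeffK v g j)) ∧
        ∀ j < m, (μ : WithTop ℚ) < v (coeffK v g j) := by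
  classical
  have key : ∀ H : ∃ i : ℕ, coeffK v g i ≠ 0 ∧ ∀ j : ℕ, v (coeffK v g i) ≤ v (coeffK v g j),
      ∃ a : ℚ, v (coeffK v g (Nat.find H)) = (a : WithTop ℚ) := by
    intro H
    obtain ⟨a, ha⟩ := WithTop.ne_top_iff_exists.1
      (mt (AddValuation.top_iff v).1 (Nat.find_spec H).1)
    exact ⟨a, ha.symm⟩
  unfold vEta
  split_ifs with H
  · obtain ⟨a, ha⟩ := key H
    rw [ha, WithTop.untopD_coe, WithTop.coe_inj, toLex_inj, Prod.mk.injEq, Nat.cast_inj]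
    constructor
    · rintro ⟨rfl, hm⟩
      subst hm
      refine ⟨ha, fun j => ha ▸ (Nat.find_spec H).2 j, fun j hj => ?_⟩
      refine lt_of_le_of_ne (ha ▸ (Nat.find_spec H).2 j) fun he => Nat.find_min H hj ⟨?_, ?_⟩
      · intro h0
        rw [h0, AddValuation.map_zero] at he
        exact WithTop.coe_ne_top he
      · intro i
        rw [← he, ← ha]
        exact (Nat.find_spec H).2 i
    · rintro ⟨h1, h2, h3⟩
      have hle := (Nat.find_spec H).2 m
      have haμ : a = μ := by
        have h4 := h2 (Nat.find H)
        rw [ha, h1] at hle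
        rw [ha] at h4
        exact le_antisymm (WithTop.coe_le_coe.1 hle) (WithTop.coe_le_coe.1 h4)
      refine ⟨haμ, le_antisymm ?_ ?_⟩
      · refine Nat.find_min' H ⟨fun h0 => ?_, fun j => h1 ▸ h2 j⟩
        rw [h0, AddValuation.map_zero] at h1
        exact WithTop.coe_ne_top h1.symm
      · by_contra! hlt
        have := h3 _ hlt
        rw [ha, haμ] at this
        exact lt_irrefl _ this
  · refine iff_of_false (WithTop.coe_ne_top ∘ Eq.symm) ?_
    rintro ⟨h1, h2, -⟩
    refine H ⟨m, fun h0 => ?_, fun j => h1 ▸ h2 j⟩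
    rw [h0, AddValuation.map_zero] at h1
    exact WithTop.coe_ne_top h1.symm

variable (v : AddValuation K (WithTop ℚ)) (p : ℕ) (f : Disk v)

/-- The algebra `Frac(A)[y]` with `y ^ p = f`, that is `Frac(A)[Y] / (Y ^ p - f)`. It is a field
as soon as `p` is prime and `f` is not a `p`-th power in `A`. -/
abbrev KummerExt : Type u :=
  AdjoinRoot
    (Polynomial.X ^ p - Polynomial.C (algebraMap (Disk v) (FractionRing (Disk v)) f))

/-- The generator `y` of `Frac(A)[y]`, with `y ^ p = f`. -/
def kummerRoot : KummerExt v p f := AdjoinRoot.root _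

/-- The integral closure `B` of `A` in `Frac(A)[y]`. -/
abbrev normalization : Subalgebra (Disk v) (KummerExt v p f) :=
  integralClosure (Disk v) (KummerExt v p f)

/-- The inclusion `K = Frac(R) → Frac(A)` extending `R → A`. -/
def constEmb : K →+* FractionRing (Disk v) :=
  IsFractionRing.lift (A := valRing v)
    (g := algebraMap (valRing v) (FractionRing (Disk v)))
    (by
      rw [IsScalarTower.algebraMap_eq (valRing v) (Disk v) (FractionRing (Disk v))]
      exact (IsFractionRing.injective (Disk v) (FractionRing (Disk v))).comp
        (PowerSeries.C_injective))

/-- The element `w = (y - h) / c` of `Frac(A)[y]`, for `h ∈ A` and `c ∈ K^×`. -/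
def kummerElt (h : Disk v) (c : K) : KummerExt v p f :=
  constEmb v c⁻¹ • (kummerRoot v p f - algebraMap (Disk v) (KummerExt v p f) h)

/-- The special fibre `B / πB` is reduced (`πB` is the ideal of `B` generated by the maximal
ideal of `R`). -/
def HasReducedSpecialFibre : Prop :=
  IsReduced (normalization v p f ⧸
    (IsLocalRing.maximalIdeal (valRing v)).map
      (algebraMap (valRing v) (normalization v p f)))

/-- The rigid space with ring `B` of functions bounded by `1` is an open disk over `K`:
`B` is isomorphic to `R⟦s⟧` as an `R`-algebra. -/
def IsOpenDisk : Prop :=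
  Nonempty (normalization v p f ≃ₐ[valRing v] PowerSeries (valRing v))

end PCyclic

end

/-!
# Cyclic covers of degree `p` of the open disk

Let `ϖ` be a uniformizer of `R`, `ζ` a primitive `p`-th root of unity, and `l` the exponent of `ϖ`
in `ζ - 1`, so that `p` is a unit times `ϖ ^ (l (p - 1))`. If `f - h ^ p = c ^ p g`, then
`w = (y - h) / c` is a root of the monic polynomial `((c X + h) ^ p - f) / c ^ p`, which is
`X ^ p + b Q - g` with `b = p / c ^ (p - 1)`; this is `twistedPoly`.

* For `c = ζ - 1` the number `b` is a unit and the equation becomes separable modulo the maximal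
  ideal of `A`. As `A` is complete, hence henselian, with algebraically closed residue field,
  it has a root, and `f` is a `p`-th power (`exists_pow_eq_of_henselian`). So the exponent of `ϖ` in
  `f - h ^ p` is always less than `p l`, which gives the bound on `μ` and the existence of the
  largest exponent `N`.
* For `c = ϖ ^ j` with `j < l` the number `b` is divisible by `ϖ`, so that `w ^ p ≡ g` modulo `ϖ`.
  If `p` did not divide `N`, this would give a nilpotent element of the special fibre
  (`dvd_of_reduced`). So `N = p j`, and `h` may be changed by multiples of `ϖ ^ j`, which
  changes the reduction of `g` by arbitrary `p`-th powers of `k⟦t⟧`. The residue field `k` being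
  perfect, all exponents divisible by `p` can be removed; the order `m` that results is prime to
  `p`, finite by the choice of `N`, and the largest possible one (`exists_best_approximation`).
* If the order `m` of the reduction of `g` is prime to `p`, then `X ^ p - g` is prime over `k⟦t⟧`.
  So `ϖ` generates a prime ideal of `A[w]`, while `p B ⊆ A[y] ⊆ A[w]`, and `B = A[w]` follows
  (`integralClosure_eq_adjoin`).
* If `m = 1`, the equation of `w` over `R⟦t⟧` can be solved for `t`, by Weierstrass preparation over
  `R⟦w⟧`, and `B` is an open disk (`exists_integralClosure_ringEquiv_powerSeries`).
-/

/-! ### Complete power series rings, exchange of variables, `p`-th powers in characteristic `p` -/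

namespace PCyclic

open PowerSeries

section Complete

variable {R : Type*} [CommRing R] (I : Ideal R)

/-- The ideal of power series whose constant term lies in `I`. -/
noncomputable def adicIdeal : Ideal R⟦X⟧ := I.comap (constantCoeff (R := R))

theorem C_mem_adicIdeal_pow {n : ℕ} {a : R} (ha : a ∈ I ^ n) : C a ∈ adicIdeal I ^ n := by
  have h : I.map (C (R := R)) ≤ adicIdeal I := by
    rw [Ideal.map_le_iff_le_comap]
    intro x hx
    simpa [adicIdeal] using hx
  exact Ideal.pow_right_mono h n (Ideal.map_pow (C (R := R)) I n ▸ Ideal.mem_map_of_mem _ ha)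

theorem X_mem_adicIdeal : (X : R⟦X⟧) ∈ adicIdeal I := by simp [adicIdeal]

theorem coeff_mem_of_mem_adicIdeal_pow {n : ℕ} {f : R⟦X⟧} (hf : f ∈ adicIdeal I ^ n) (i : ℕ) :
    coeff i f ∈ I ^ (n - i) := by
  induction n generalizing f i with
  | zero => simp
  | succ n ih =>
    rw [pow_succ] at hf
    refine Submodule.mul_induction_on hf (fun a ha b hb => ?_) fun a b ha hb => ?_
    · rw [coeff_mul]
      refine Ideal.sum_mem _ fun x hx => ?_
      rw [Finset.HasAntidiagonal.mem_antidiagonal] at hx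
      rcases Nat.eq_zero_or_pos x.2 with h0 | h0
      · have hb' : coeff x.2 b ∈ I := by simpa [h0, adicIdeal] using hb
        have := Ideal.mul_mem_mul (ih ha x.1) hb'
        rw [← pow_succ] at this
        exact Ideal.pow_le_pow_right (by omega) this
      · exact Ideal.mul_mem_right _ _ (Ideal.pow_le_pow_right (by omega) (ih ha x.1))
    · rw [map_add]
      exact Ideal.add_mem _ ha hb

theorem mem_adicIdeal_pow_iff {n : ℕ} {f : R⟦X⟧} :
    f ∈ adicIdeal I ^ n ↔ ∀ i < n, coeff i f ∈ I ^ (n - i) := by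
  refine ⟨fun h i _ => coeff_mem_of_mem_adicIdeal_pow I h i, fun h => ?_⟩
  induction n generalizing f with
  | zero => simp
  | succ n ih =>
    rw [eq_X_mul_shift_add_const f]
    refine Ideal.add_mem _ ?_ ?_
    · rw [pow_succ']
      refine Ideal.mul_mem_mul (X_mem_adicIdeal I) (ih fun i hi => ?_)
      simpa using h (i + 1) (by omega)
    · exact C_mem_adicIdeal_pow I (by simpa using h 0 (by omega))

/-- A power series ring over an `I`-adically complete ring is complete for the ideal generated by
`I` and the variable. -/
theorem isAdicComplete_adicIdeal [IsAdicComplete I R] : IsAdicComplete (adicIdeal I) R⟦X⟧ where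
  haus' f hf := by
    ext i
    rw [map_zero]
    refine IsHausdorff.haus (I := I) inferInstance _ fun n => ?_
    have := hf (n + i)
    rw [SModEq.zero, smul_eq_mul, Ideal.mul_top] at this ⊢
    simpa using coeff_mem_of_mem_adicIdeal_pow I this i
  prec' f hf := by
    have key : ∀ i : ℕ, ∃ l : R, ∀ n, coeff i (f (n + i)) ≡ l [SMOD (I ^ n • ⊤ : Ideal R)] := by
      intro i
      refine IsPrecomplete.prec inferInstance fun {m n} hmn => ?_
      have := hf (Nat.add_le_add_right hmn i)
      rw [SModEq.sub_mem, smul_eq_mul, Ideal.mul_top] at this ⊢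
      simpa using coeff_mem_of_mem_adicIdeal_pow I this i
    choose l hl using key
    refine ⟨PowerSeries.mk l, fun n => ?_⟩
    rw [SModEq.sub_mem, smul_eq_mul, Ideal.mul_top, mem_adicIdeal_pow_iff]
    intro i hi
    have := hl i (n - i)
    rw [SModEq.sub_mem, smul_eq_mul, Ideal.mul_top, Nat.sub_add_cancel hi.le] at this
    simpa using this

theorem maximalIdeal_eq_adicIdeal [IsLocalRing R] :
    IsLocalRing.maximalIdeal R⟦X⟧ = adicIdeal (IsLocalRing.maximalIdeal R) := by
  ext f
  rw [IsLocalRing.mem_maximalIdeal, mem_nonunits_iff, isUnit_iff_constantCoeff]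
  rfl

instance isAdicComplete_powerSeries [IsLocalRing R]
    [IsAdicComplete (IsLocalRing.maximalIdeal R) R] :
    IsAdicComplete (IsLocalRing.maximalIdeal R⟦X⟧) R⟦X⟧ := by
  rw [maximalIdeal_eq_adicIdeal]
  exact isAdicComplete_adicIdeal _

end Complete

section Swap

variable (R : Type*) [CommRing R]

/-- The exchange of the two variables, `R⟦t⟧⟦s⟧ ≃ R⟦s⟧⟦t⟧`. -/
noncomputable def swapVars : R⟦X⟧⟦X⟧ ≃+* R⟦X⟧⟦X⟧ where
  toFun f := PowerSeries.mk fun i => PowerSeries.mk fun j => coeff i (coeff j f)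
  invFun f := PowerSeries.mk fun i => PowerSeries.mk fun j => coeff i (coeff j f)
  left_inv f := by ext i j; simp
  right_inv f := by ext i j; simp
  map_add' f g := by ext i j; simp
  map_mul' f g := by
    ext i j
    simp only [coeff_mk, coeff_mul, map_sum]
    exact Finset.sum_comm

variable {R}

@[simp] theorem coeff_coeff_swapVars (f : R⟦X⟧⟦X⟧) (i j : ℕ) :
    coeff j (coeff i (swapVars R f)) = coeff i (coeff j f) := by
  simp [swapVars]

theorem swapVars_C_C (r : R) : swapVars R (C (C r)) = C (C r) := by
  ext i j
  simp only [coeff_coeff_swapVars, coeff_C]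
  split_ifs <;> simp_all [coeff_C]

end Swap

section Frobenius

variable {k : Type*} [Field k] {p : ℕ}

theorem coeff_pow_char [CharP k p] (hp : p.Prime) (q : k⟦X⟧) (i : ℕ) :
    coeff i (q ^ p) = if p ∣ i then coeff (i / p) q ^ p else 0 := by
  have : ExpChar k p := ExpChar.prime hp
  have h : (q.expand p hp.ne_zero).map (frobenius k p) = q ^ p :=
    MvPowerSeries.map_frobenius_expand p hp.ne_zero
  rw [← h, coeff_map, coeff_expand]
  split_ifs <;> simp [frobenius_def, hp.ne_zero]

/-- Over a perfect field of characteristic `p` (here: an algebraically closed one) the exponents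
divisible by `p` can be removed from a power series by subtracting a `p`-th power. -/
theorem exists_coeff_sub_pow [CharP k p] [IsAlgClosed k] (hp : p.Prime) (g : k⟦X⟧) :
    ∃ q : k⟦X⟧, ∀ i, p ∣ i → coeff i (g - q ^ p) = 0 := by
  choose r hr using fun a : k => IsAlgClosed.exists_pow_nat_eq a hp.pos
  refine ⟨PowerSeries.mk fun i => r (coeff (p * i) g), ?_⟩
  rintro _ ⟨i, rfl⟩
  rw [map_sub, coeff_pow_char hp, if_pos (dvd_mul_right _ _), coeff_mk,
    Nat.mul_div_cancel_left _ hp.pos, hr, sub_self]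

end Frobenius

end PCyclic

/-! ### The equation of `(y - h) / c` -/

namespace PCyclic

open Polynomial

section KummerPoly

variable {A : Type*} [CommRing A] (p : ℕ) (b c g h : A)

/-- The sum `∑_{0 < i < p} (1 / p) (p.choose i) c ^ (i - 1) h ^ (p - i) X ^ i` (for a prime `p` the
division of natural numbers is exact): if `p = c ^ (p - 1) b`, then
`((c X + h) ^ p - h ^ p) / c ^ p = X ^ p + b * middlePoly p c h`. -/
noncomputable def middlePoly : A[X] :=
  ∑ i ∈ Finset.Ico 1 p, C (((p.choose i / p : ℕ) : A) * c ^ (i - 1) * h ^ (p - i)) * X ^ i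

/-- If `p = c ^ (p - 1) b` and `f = h ^ p + c ^ p g`, this monic polynomial is
`((c X + h) ^ p - f) / c ^ p`; it has the root `(y - h) / c` whenever `y ^ p = f`. -/
noncomputable def twistedPoly : A[X] := X ^ p + C b * middlePoly p c h - C g

theorem C_pow_mul_twistedPoly {p : ℕ} (hp : p.Prime) {f : A} (hb : (p : A) = c ^ (p - 1) * b)
    (hf : f = h ^ p + c ^ p * g) :
    C (c ^ p) * twistedPoly p b c g h = (C c * X + C h) ^ p - C f := by
  have hterm : ∀ i ∈ Finset.Ico 1 p,
      C (c ^ p) * (C b * (C (((p.choose i / p : ℕ) : A) * c ^ (i - 1) * h ^ (p - i)) * X ^ i)) =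
        (C c * X) ^ i * C h ^ (p - i) * (p.choose i : A[X]) := by
    intro i hi
    rw [Finset.mem_Ico] at hi
    obtain ⟨n, hn⟩ := hp.dvd_choose_self (by omega : i ≠ 0) hi.2
    have hdiv : p.choose i / p = n := by rw [hn, Nat.mul_div_cancel_left _ hp.pos]
    have h1 : (p.choose i : A[X]) = C (c ^ (p - 1) * b * (n : A)) := by
      rw [hn, ← hb]; simp
    obtain ⟨j, rfl⟩ : ∃ j, i = j + 1 := ⟨i - 1, by omega⟩
    obtain ⟨m, rfl⟩ : ∃ m, p = m + 1 := ⟨p - 1, by omega⟩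
    rw [hdiv, h1]
    simp only [map_mul, map_pow, Nat.add_sub_cancel]
    ring
  rw [add_pow, Finset.sum_range_succ, Finset.range_eq_Ico,
    Finset.sum_eq_sum_Ico_succ_bot hp.pos, twistedPoly, middlePoly, mul_sub, mul_add,
    Finset.mul_sum, Finset.mul_sum, Finset.sum_congr rfl hterm, hf]
  simp
  ring

variable {p}

theorem degree_middlePoly_lt : (middlePoly p c h).degree < p := by
  refine (degree_sum_le _ _).trans_lt ((Finset.sup_lt_iff (WithBot.bot_lt_coe p)).2 fun i hi => ?_)
  rw [Finset.mem_Ico] at hi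
  exact (degree_C_mul_X_pow_le _ _).trans_lt (WithBot.coe_lt_coe.2 hi.2)

theorem twistedPoly_monic_and_natDegree [Nontrivial A] (hp : p.Prime) :
    (twistedPoly p b c g h).Monic ∧ (twistedPoly p b c g h).natDegree = p := by
  have hlt : (C b * middlePoly p c h - C g).degree < p := by
    refine (degree_sub_le _ _).trans_lt (max_lt ?_ ?_)
    · rw [← smul_eq_C_mul]
      exact (degree_smul_le _ _).trans_lt (degree_middlePoly_lt c h)
    · exact degree_C_le.trans_lt (by exact_mod_cast hp.pos)
  rw [twistedPoly, add_sub_assoc]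
  exact ⟨monic_X_pow_add hlt, natDegree_eq_of_degree_eq_some
    ((degree_add_eq_left_of_degree_lt (by rwa [degree_X_pow])).trans (degree_X_pow p))⟩

theorem middlePoly_coeff_zero : (middlePoly p c h).coeff 0 = 0 := by
  rw [middlePoly, finsetSum_coeff]
  refine Finset.sum_eq_zero fun i hi => ?_
  rw [Finset.mem_Ico] at hi
  rw [coeff_C_mul_X_pow, if_neg (by omega)]

theorem map_twistedPoly {S : Type*} [CommRing S] (φ : A →+* S) :
    (twistedPoly p b c g h).map φ = twistedPoly p (φ b) (φ c) (φ g) (φ h) := by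
  simp [twistedPoly, middlePoly, Polynomial.map_sum]

theorem twistedPoly_zero_left : twistedPoly p 0 c g h = X ^ p - C g := by
  simp [twistedPoly]

theorem middlePoly_zero (hp : p.Prime) : middlePoly p 0 h = C (h ^ (p - 1)) * X := by
  rw [middlePoly, Finset.sum_eq_single_of_mem 1 (Finset.mem_Ico.2 ⟨le_rfl, hp.one_lt⟩)]
  · simp [Nat.div_self hp.pos]
  · intro i hi h1
    rw [Finset.mem_Ico] at hi
    rw [zero_pow (by omega)]
    simp

/-- If `f = h ^ p + l ^ p g` where `h` is a unit and `p = l ^ (p - 1) b` with `b` a unit and `l` not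
a unit, then `f` is a `p`-th power: `y = h + l w` where `w ^ p + b h ^ (p - 1) w ≡ g` modulo the
maximal ideal, a separable equation, is solved by Hensel's lemma. -/
theorem exists_pow_eq_of_henselian [HenselianLocalRing A] {p : ℕ} (hp : p.Prime)
    [IsAlgClosed (IsLocalRing.ResidueField A)]
    {f l : A} (hl : l ∈ IsLocalRing.maximalIdeal A) (hb : IsUnit b)
    (hpl : (p : A) = l ^ (p - 1) * b) (hh : IsUnit h) (hf : f = h ^ p + l ^ p * g) :
    ∃ y : A, y ^ p = f := by
  set k := IsLocalRing.ResidueField A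
  set F := twistedPoly p b l g h with hF
  obtain ⟨hmon, hdeg⟩ := twistedPoly_monic_and_natDegree b l g h hp
  have hmap : F.map (IsLocalRing.residue A) =
      X ^ p + C (IsLocalRing.residue A b) *
        (C (IsLocalRing.residue A h ^ (p - 1)) * X) - C (IsLocalRing.residue A g) := by
    rw [hF, map_twistedPoly, (IsLocalRing.residue_eq_zero_iff l).2 hl, twistedPoly,
      middlePoly_zero _ hp]
  have hpk : (p : k) = 0 := by
    rw [← map_natCast (IsLocalRing.residue A), hpl, map_mul, map_pow,
      (IsLocalRing.residue_eq_zero_iff l).2 hl,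
      zero_pow (Nat.sub_ne_zero_of_lt hp.one_lt), zero_mul]
  obtain ⟨a, ha⟩ : ∃ a : k, (F.map (IsLocalRing.residue A)).IsRoot a := by
    refine IsAlgClosed.exists_root _ ?_
    rw [hmon.degree_map]
    rw [degree_eq_natDegree hmon.ne_zero, hdeg]
    exact_mod_cast hp.ne_zero
  have hder : (derivative (F.map (IsLocalRing.residue A))).eval a ≠ 0 := by
    rw [hmap]
    have h1 : IsUnit (IsLocalRing.residue A b) := hb.map _
    have h2 : IsUnit (IsLocalRing.residue A h) := hh.map _
    rw [derivative_sub, derivative_add, derivative_X_pow, derivative_C_mul, derivative_C_mul_X,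
      derivative_C, hpk]
    simpa using ⟨h1.ne_zero, fun h0 => absurd h0 h2.ne_zero⟩
  obtain ⟨w, hw, -⟩ := ((HenselianLocalRing.TFAE A).out 0 1 rfl rfl).1 inferInstance F hmon a
    (by rw [aeval_def, ← eval_map]; exact ha)
    (by rw [aeval_def, ← eval_map, ← derivative_map]; exact hder)
  refine ⟨l * w + h, ?_⟩
  have := congrArg (eval w) (C_pow_mul_twistedPoly b l g h hp hpl hf)
  rw [eval_mul, show eval w (twistedPoly p b l g h) = 0 from hw, mul_zero] at this
  simp only [eval_sub, eval_pow, eval_add, eval_mul, eval_C, eval_X] at this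
  exact sub_eq_zero.1 this.symm

end KummerPoly

end PCyclic

/-! ### Integral elements of a Kummer extension -/

namespace PCyclic

open Polynomial

section Kummer

variable {A F : Type*} [CommRing A] [Field F] [Algebra A F] {p : ℕ} {f : A}

/-- The endomorphism `y ↦ ζ y` of `F[Y] / (Y ^ p - f)`, for `ζ ^ p = 1`. -/
noncomputable def rotate (f ζ : A) (hζ : ζ ^ p = 1) :
    AdjoinRoot (X ^ p - C (algebraMap A F f)) →ₐ[F]
      AdjoinRoot (X ^ p - C (algebraMap A F f)) :=
  AdjoinRoot.liftAlgHom _ (Algebra.ofId F _)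
    (algebraMap A _ ζ * AdjoinRoot.root (X ^ p - C (algebraMap A F f))) (by
      have h := AdjoinRoot.eval₂_root (X ^ p - C (algebraMap A F f))
      rw [eval₂_sub, eval₂_pow, eval₂_X, eval₂_C] at h ⊢
      rw [mul_pow, ← map_pow, hζ, map_one, one_mul]
      exact h)

theorem rotate_root (ζ : A) (hζ : ζ ^ p = 1) :
    rotate (F := F) f ζ hζ (AdjoinRoot.root _) = algebraMap A _ ζ * AdjoinRoot.root _ := by
  simp [rotate]

theorem rotate_algebraMap (ζ : A) (hζ : ζ ^ p = 1) (a : A) :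
    rotate (F := F) f ζ hζ (algebraMap A _ a) = algebraMap A _ a := by
  rw [IsScalarTower.algebraMap_apply A F (AdjoinRoot (X ^ p - C (algebraMap A F f))),
    AlgHom.commutes]

theorem isIntegral_rotate (ζ : A) (hζ : ζ ^ p = 1)
    {x : AdjoinRoot (X ^ p - C (algebraMap A F f))} (hx : IsIntegral A x) :
    IsIntegral A (rotate f ζ hζ x) :=
  hx.map ((rotate f ζ hζ).restrictScalars A)

theorem root_pow_eq : (AdjoinRoot.root (X ^ p - C (algebraMap A F f))) ^ p = algebraMap A _ f := by
  have h := AdjoinRoot.eval₂_root (X ^ p - C (algebraMap A F f))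
  rw [eval₂_sub, eval₂_pow, eval₂_X, eval₂_C, sub_eq_zero] at h
  rw [h]
  rfl

theorem isIntegral_root (hp : p.Prime) :
    IsIntegral A (AdjoinRoot.root (X ^ p - C (algebraMap A F f))) := by
  refine IsIntegral.of_pow hp.pos ?_
  rw [root_pow_eq]
  exact isIntegral_algebraMap

theorem algebraMap_kummer_injective (hp : p.Prime) :
    Function.Injective (algebraMap F (AdjoinRoot (X ^ p - C (algebraMap A F f)))) := by
  refine AdjoinRoot.of.injective_of_degree_ne_zero ?_
  rw [degree_X_pow_sub_C hp.pos]
  exact_mod_cast hp.ne_zero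

theorem exists_eq_sum_root_pow (hp : p.Prime) (x : AdjoinRoot (X ^ p - C (algebraMap A F f))) :
    ∃ a : ℕ → F, x = ∑ i ∈ Finset.range p, algebraMap F _ (a i) * AdjoinRoot.root _ ^ i := by
  obtain ⟨q, rfl⟩ := AdjoinRoot.mk_surjective x
  have hmon : (X ^ p - C (algebraMap A F f)).Monic := monic_X_pow_sub_C _ hp.ne_zero
  refine ⟨(q %ₘ (X ^ p - C (algebraMap A F f))).coeff, ?_⟩
  rw [AdjoinRoot.mk_eq_mk.2 (show (X ^ p - C (algebraMap A F f)) ∣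
    q - q %ₘ (X ^ p - C (algebraMap A F f)) from ⟨_, sub_eq_of_eq_add'
      (modByMonic_add_div q (X ^ p - C (algebraMap A F f))).symm⟩), ← AdjoinRoot.aeval_eq,
    aeval_eq_sum_range' (n := p)]
  · exact Finset.sum_congr rfl fun i _ => Algebra.smul_def _ _
  · refine (natDegree_modByMonic_lt _ hmon fun h => ?_).trans_eq natDegree_X_pow_sub_C
    have := congrArg natDegree h
    rw [natDegree_X_pow_sub_C, natDegree_one] at this
    exact hp.ne_zero this

theorem sum_pow_mul_pow_eq [IsDomain A] (hp : p.Prime) {ζ : A} (hζ : IsPrimitiveRoot ζ p)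
    {i k : ℕ} (hi : i < p) (hk : k < p) :
    ∑ j ∈ Finset.range p, (ζ ^ j) ^ (p - k) * (ζ ^ j) ^ i = if i = k then (p : A) else 0 := by
  have : ∀ j, (ζ ^ j) ^ (p - k) * (ζ ^ j) ^ i = (ζ ^ (p - k + i)) ^ j := fun j => by
    rw [← pow_add, ← pow_mul, ← pow_mul, mul_comm]
  simp_rw [this]
  split_ifs with h
  · subst h
    simp [Nat.sub_add_cancel hi.le, hζ.pow_eq_one]
  · refine (hζ.pow_of_coprime _ ?_).geom_sum_eq_zero hp.one_lt
    refine (Nat.Coprime.symm ((Nat.Prime.coprime_iff_not_dvd hp).2 fun hd => h ?_))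
    obtain ⟨d, hd⟩ := hd
    have h1 : p * d < p * 2 := by omega
    have h2 : d < 2 := lt_of_mul_lt_mul_left h1 (Nat.zero_le _)
    interval_cases d <;> omega

variable [IsDomain A] [IsIntegrallyClosed A] [IsFractionRing A F]

/-- An integral element `∑ aᵢ yⁱ` satisfies `p aᵢ yⁱ = ∑_ζ ζ⁻ⁱ σ_ζ x`, so that all `p aᵢ` are in
`A` if `y ^ p` is a unit of `A`. -/
theorem exists_natCast_mul_eq_aeval_root (hp : p.Prime) {ζ : A} (hζ : IsPrimitiveRoot ζ p)
    (hf : IsUnit f) {x : AdjoinRoot (X ^ p - C (algebraMap A F f))} (hx : IsIntegral A x) :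
    ∃ q : A[X], (p : AdjoinRoot (X ^ p - C (algebraMap A F f))) * x =
      aeval (AdjoinRoot.root (X ^ p - C (algebraMap A F f))) q := by
  obtain ⟨a, ha⟩ := exists_eq_sum_root_pow hp x
  set y := AdjoinRoot.root (X ^ p - C (algebraMap A F f)) with hy
  have hone : ∀ j : ℕ, (ζ ^ j) ^ p = 1 := fun j => by
    rw [← pow_mul, mul_comm, pow_mul, hζ.pow_eq_one, one_pow]
  have hcoef : ∀ k < p, ∃ α : A, algebraMap A F α = (p : F) * a k := by
    intro k hk
    have h1 : ∑ j ∈ Finset.range p,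
        algebraMap A _ ((ζ ^ j) ^ (p - k)) * rotate f (ζ ^ j) (hone j) x =
          algebraMap F _ (p * a k) * y ^ k := by
      have h2 : ∀ j, rotate f (ζ ^ j) (hone j) x = ∑ i ∈ Finset.range p,
          algebraMap A _ ((ζ ^ j) ^ i) * (algebraMap F _ (a i) * y ^ i) := by
        intro j
        conv_lhs => rw [ha]
        rw [map_sum]
        refine Finset.sum_congr rfl fun i _ => ?_
        rw [map_mul, map_pow, AlgHom.commutes, rotate_root, mul_pow,
          map_pow (algebraMap A _) (ζ ^ j)]
        ring
      simp_rw [h2, Finset.mul_sum]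
      rw [Finset.sum_comm]
      simp_rw [← mul_assoc (algebraMap A _ _), ← map_mul (algebraMap A _), ← Finset.sum_mul,
        ← map_sum]
      rw [Finset.sum_eq_single_of_mem k (Finset.mem_range.2 hk)]
      · rw [sum_pow_mul_pow_eq hp hζ hk hk, if_pos rfl]
        simp [mul_assoc]
      · intro i hi hik
        rw [sum_pow_mul_pow_eq hp hζ (Finset.mem_range.1 hi) hk, if_neg hik, map_zero, zero_mul,
          zero_mul]
    have h3 : IsIntegral A (algebraMap F (AdjoinRoot (X ^ p - C (algebraMap A F f)))
        (p * a k * algebraMap A F f)) := by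
      have h4 : algebraMap F (AdjoinRoot (X ^ p - C (algebraMap A F f)))
          (p * a k * algebraMap A F f) = algebraMap F _ (p * a k) * y ^ k * y ^ (p - k) := by
        rw [mul_assoc _ (y ^ k), ← pow_add, Nat.add_sub_cancel' hk.le, root_pow_eq,
          map_mul _ (p * a k),
          ← IsScalarTower.algebraMap_apply]
      rw [h4, ← h1]
      refine IsIntegral.mul (IsIntegral.sum _ fun j _ => ?_) ((isIntegral_root hp).pow _)
      exact isIntegral_algebraMap.mul (isIntegral_rotate _ _ hx)
    rw [isIntegral_algebraMap_iff (algebraMap_kummer_injective hp)] at h3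
    obtain ⟨β, hβ⟩ := IsIntegrallyClosed.isIntegral_iff.1 h3
    obtain ⟨u, hu⟩ := hf
    refine ⟨β * ↑u⁻¹, ?_⟩
    rw [map_mul, hβ, mul_assoc, ← map_mul, ← hu, Units.mul_inv, map_one, mul_one]
  choose! α hα using hcoef
  refine ⟨∑ i ∈ Finset.range p, C (α i) * X ^ i, ?_⟩
  rw [map_sum]
  conv_lhs => rw [ha]
  rw [Finset.mul_sum]
  refine Finset.sum_congr rfl fun i hi => ?_
  rw [map_mul, aeval_C, map_pow, aeval_X,
    IsScalarTower.algebraMap_apply A F (AdjoinRoot (X ^ p - C (algebraMap A F f))),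
    hα i (Finset.mem_range.1 hi), map_mul, map_natCast, mul_assoc]

/-- If `(y - h) / c` is integral over `A`, then so is its norm `± (f - h ^ p) / c ^ p`. -/
theorem pow_dvd_of_isIntegral (hp : p.Prime) {ζ : A} (hζ : IsPrimitiveRoot ζ p) {c h : A}
    (hc : c ≠ 0) {x : AdjoinRoot (X ^ p - C (algebraMap A F f))} (hx : IsIntegral A x)
    (hxc : algebraMap A _ c * x = AdjoinRoot.root _ - algebraMap A _ h) :
    c ^ p ∣ f - h ^ p := by
  set y := AdjoinRoot.root (X ^ p - C (algebraMap A F f)) with hy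
  have hζC : IsPrimitiveRoot (C ζ : A[X]) p := hζ.map_of_injective C_injective
  have hroot : ∀ z ∈ nthRootsFinset p (1 : A[X]), ∃ a : A, a ^ p = 1 ∧ z = C a := by
    intro z hz
    have : NeZero p := ⟨hp.ne_zero⟩
    obtain ⟨i, -, hi⟩ := hζC.eq_pow_of_pow_eq_one ((mem_nthRootsFinset hp.pos 1).1 hz)
    exact ⟨ζ ^ i, by rw [← pow_mul, mul_comm, pow_mul, hζ.pow_eq_one, one_pow],
      by rw [← hi, map_pow]⟩
  have hfac : ∀ z ∈ nthRootsFinset p (1 : A[X]), ∃ w : AdjoinRoot (X ^ p - C (algebraMap A F f)),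
      IsIntegral A w ∧ aeval y (C h - z * X) = algebraMap A _ c * w := by
    intro z hz
    obtain ⟨a, ha, rfl⟩ := hroot z hz
    refine ⟨-rotate f a ha x, (isIntegral_rotate a ha hx).neg, ?_⟩
    have h1 := congrArg (rotate f a ha) hxc
    rw [map_mul, map_sub, rotate_algebraMap, rotate_algebraMap, rotate_root] at h1
    rw [mul_neg, h1]
    simp [hy]
  choose! w hw hw' using hfac
  have h1 : algebraMap A (AdjoinRoot (X ^ p - C (algebraMap A F f))) (h ^ p - f) =
      algebraMap A _ (c ^ p) * ∏ z ∈ nthRootsFinset p (1 : A[X]), w z := by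
    have h2 := congrArg (aeval y) (hζC.pow_sub_pow_eq_prod_sub_mul (C h) X hp.pos)
    rw [map_prod, Finset.prod_congr rfl hw', Finset.prod_mul_distrib, Finset.prod_const,
      hζC.card_nthRootsFinset] at h2
    rw [map_sub, ← root_pow_eq, map_pow _ c, ← h2]
    simp [hy]
  have hcF : algebraMap A F c ≠ 0 := by
    rwa [Ne, FaithfulSMul.algebraMap_eq_zero_iff]
  have h3 : ∏ z ∈ nthRootsFinset p (1 : A[X]), w z =
      algebraMap F _ (algebraMap A F (h ^ p - f) / algebraMap A F (c ^ p)) := by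
    have h4 : algebraMap A (AdjoinRoot (X ^ p - C (algebraMap A F f))) (c ^ p) *
        algebraMap F _ (algebraMap A F (c ^ p))⁻¹ = 1 := by
      rw [IsScalarTower.algebraMap_apply A F (AdjoinRoot (X ^ p - C (algebraMap A F f))),
        ← map_mul, mul_inv_cancel₀ (by rw [map_pow]; exact pow_ne_zero _ hcF), map_one]
    rw [div_eq_mul_inv, map_mul, ← IsScalarTower.algebraMap_apply, h1, mul_right_comm, h4, one_mul]
  have h5 : IsIntegral A (∏ z ∈ nthRootsFinset p (1 : A[X]), w z) := IsIntegral.prod _ hw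
  rw [h3, isIntegral_algebraMap_iff (algebraMap_kummer_injective hp)] at h5
  obtain ⟨β, hβ⟩ := IsIntegrallyClosed.isIntegral_iff.1 h5
  refine ⟨-β, FaithfulSMul.algebraMap_injective A F ?_⟩
  rw [eq_div_iff (by rw [map_pow]; exact pow_ne_zero _ hcF)] at hβ
  rw [map_mul, map_neg, mul_neg, mul_comm, hβ, ← map_neg, neg_sub]

end Kummer

end PCyclic

/-! ### Integral closures generated by one element -/

namespace PCyclic

open Polynomial

section Generator

variable {A F : Type*} [CommRing A] [IsDomain A] [Field F] [Algebra A F] [IsFractionRing A F]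
  {p : ℕ} {f b c g h : A} {w : AdjoinRoot (X ^ p - C (algebraMap A F f))}

theorem isUnit_algebraMap_kummer (hc : c ≠ 0) :
    IsUnit (algebraMap A (AdjoinRoot (X ^ p - C (algebraMap A F f))) c) := by
  rw [IsScalarTower.algebraMap_apply A F (AdjoinRoot (X ^ p - C (algebraMap A F f)))]
  refine IsUnit.map _ (IsUnit.mk0 _ ?_)
  rwa [Ne, FaithfulSMul.algebraMap_eq_zero_iff]

theorem aeval_twistedPoly (hp : p.Prime) (hc : c ≠ 0) (hb : (p : A) = c ^ (p - 1) * b)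
    (hf : f = h ^ p + c ^ p * g)
    (hw : algebraMap A _ c * w = AdjoinRoot.root _ - algebraMap A _ h) :
    aeval w (twistedPoly p b c g h) = 0 := by
  have h1 := congrArg (aeval w) (C_pow_mul_twistedPoly b c g h hp hb hf)
  rw [map_mul, aeval_C, map_sub, map_pow (aeval w), map_add, map_mul, aeval_C, aeval_C, aeval_C,
    aeval_X, hw, sub_add_cancel, root_pow_eq, sub_self] at h1
  exact ((isUnit_algebraMap_kummer (pow_ne_zero p hc)).mul_right_eq_zero).1 h1

theorem aeval_eq_zero_iff_twistedPoly_dvd (hp : p.Prime) (hc : c ≠ 0)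
    (hb : (p : A) = c ^ (p - 1) * b) (hf : f = h ^ p + c ^ p * g)
    (hw : algebraMap A _ c * w = AdjoinRoot.root _ - algebraMap A _ h) (q : A[X]) :
    aeval w q = 0 ↔ twistedPoly p b c g h ∣ q := by
  refine ⟨fun hq => ?_, fun ⟨r, hr⟩ => by
    rw [hr, map_mul, aeval_twistedPoly hp hc hb hf hw, zero_mul]⟩
  have hcF : algebraMap A F c ≠ 0 := by rwa [Ne, FaithfulSMul.algebraMap_eq_zero_iff]
  set s : F[X] := C (algebraMap A F c)⁻¹ * (X - C (algebraMap A F h)) with hs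
  set s' : F[X] := C (algebraMap A F c) * X + C (algebraMap A F h) with hs'
  have hss' : s.comp s' = X := by
    rw [hs, hs']
    simp only [mul_comp, C_comp, sub_comp, X_comp, add_sub_cancel_right]
    rw [← mul_assoc, ← C_mul, inv_mul_cancel₀ hcF, C_1, one_mul]
  have haw : aeval (AdjoinRoot.root (X ^ p - C (algebraMap A F f))) s = w := by
    have h1 : algebraMap A (AdjoinRoot (X ^ p - C (algebraMap A F f))) c =
        algebraMap F _ (algebraMap A F c) := IsScalarTower.algebraMap_apply _ _ _ _
    rw [hs, map_mul, map_sub, aeval_C, aeval_C, aeval_X, ← IsScalarTower.algebraMap_apply, ← hw, h1,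
      ← mul_assoc, ← map_mul, inv_mul_cancel₀ hcF, map_one, one_mul]
  have h1 : (X ^ p - C (algebraMap A F f)) ∣ (q.map (algebraMap A F)).comp s := by
    rw [← AdjoinRoot.mk_eq_zero, ← AdjoinRoot.aeval_eq, aeval_comp, haw, aeval_map_algebraMap]
    exact hq
  have h2 : (X ^ p - C (algebraMap A F f)).comp s' =
      C (algebraMap A F c ^ p) * (twistedPoly p b c g h).map (algebraMap A F) := by
    have := congrArg (Polynomial.map (algebraMap A F)) (C_pow_mul_twistedPoly b c g h hp hb hf)
    simp only [Polynomial.map_mul, Polynomial.map_sub, Polynomial.map_pow, Polynomial.map_add,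
      map_C, map_X, map_pow] at this
    rw [map_pow, this, hs']
    simp
  have h3 := _root_.map_dvd (compRingHom s') h1
  rw [coe_compRingHom_apply, coe_compRingHom_apply] at h3
  rw [comp_assoc, hss', comp_X, h2] at h3
  exact (Polynomial.map_dvd_map _ (FaithfulSMul.algebraMap_injective A F)
    (twistedPoly_monic_and_natDegree b c g h hp).1).1 (dvd_of_mul_left_dvd h3)

/-- `A[w]` is the integral closure of `A` in `F[Y] / (Y ^ p - f)`, where `w = (y - h) / c`, if the
special fibre `A[w] / π`, defined by `X ^ p - g` modulo `π`, is a domain. Up to powers of `π` the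
two rings agree, as `p` times an integral element is in `A[y]`; and if `x` is integral
and `π x = q(w)` for a polynomial `q`, then `π` divides a power of `q(w)` in `A[w]`, hence divides
`q(w)`. -/
theorem integralClosure_eq_adjoin [IsIntegrallyClosed A] {S : Type*} [CommRing S]
    (hp : p.Prime) {ζ : A} (hζ : IsPrimitiveRoot ζ p) (hfu : IsUnit f) (hc : c ≠ 0)
    (hb : (p : A) = c ^ (p - 1) * b) (hf : f = h ^ p + c ^ p * g)
    (hw : algebraMap A _ c * w = AdjoinRoot.root _ - algebraMap A _ h)
    {π : A} (hπ : π ≠ 0) {e : ℕ} (hpe : (p : A) ∣ π ^ e)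
    (ρ : A →+* S) (hρ : Function.Surjective ρ) (hker : ∀ a, ρ a = 0 ↔ π ∣ a) (hρb : ρ b = 0)
    (hprime : Prime (X ^ p - C (ρ g))) :
    integralClosure A (AdjoinRoot (X ^ p - C (algebraMap A F f))) = Algebra.adjoin A {w} := by
  have hmon := (twistedPoly_monic_and_natDegree b c g h hp).1
  have hFmap : (twistedPoly p b c g h).map ρ = X ^ p - C (ρ g) := by
    rw [map_twistedPoly, hρb, twistedPoly_zero_left]
  have hwint : IsIntegral A w :=
    ⟨_, hmon, by rw [← aeval_def]; exact aeval_twistedPoly hp hc hb hf hw⟩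
  refine le_antisymm ?_ (adjoin_le_integralClosure hwint)
  have hpoly : ∀ q : A[X], q.map ρ = 0 → ∃ r : A[X], q = C π * r := by
    intro q hq
    have : C π ∣ q := (C_dvd_iff_dvd_coeff _ _).2 fun i => (hker _).1 (by
      rw [← coeff_map, hq, coeff_zero])
    exact this
  have hdesc : ∀ x : AdjoinRoot (X ^ p - C (algebraMap A F f)), IsIntegral A x →
      ∀ q : A[X], algebraMap A _ π * x = aeval w q → ∃ r : A[X], x = aeval w r := by
    intro x hx q hq
    obtain ⟨P, hP, hPx⟩ := hx
    have hsum : ∃ r : A[X], aeval w (q ^ P.natDegree) = aeval w (C π * r) := by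
      have h1 := congrArg (algebraMap A _ π ^ P.natDegree * ·) hPx
      simp only [mul_zero] at h1
      rw [eval₂_eq_sum_range, Finset.sum_range_succ, hP.coeff_natDegree, map_one, one_mul, mul_add,
        ← mul_pow, hq, ← map_pow (aeval w)] at h1
      refine ⟨-∑ i ∈ Finset.range P.natDegree,
        C (P.coeff i) * C π ^ (P.natDegree - i - 1) * q ^ i, ?_⟩
      rw [add_comm] at h1
      rw [eq_neg_of_add_eq_zero_left h1, mul_neg, map_neg, Finset.mul_sum, Finset.mul_sum, map_sum]
      refine congrArg _ (Finset.sum_congr rfl fun i hi => ?_)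
      rw [Finset.mem_range] at hi
      simp only [map_mul, map_pow, aeval_C, ← hq]
      obtain ⟨d, hd⟩ : ∃ d, P.natDegree = i + d + 1 := ⟨P.natDegree - i - 1, by omega⟩
      rw [hd, show i + d + 1 - i - 1 = d by omega]
      ring
    obtain ⟨r, hr⟩ := hsum
    rw [← sub_eq_zero, ← map_sub, aeval_eq_zero_iff_twistedPoly_dvd hp hc hb hf hw] at hr
    have h2 := Polynomial.map_dvd ρ hr
    rw [hFmap, Polynomial.map_sub, Polynomial.map_mul, map_C, (hker π).2 dvd_rfl, C_0, zero_mul,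
      sub_zero, Polynomial.map_pow] at h2
    obtain ⟨t, ht⟩ := hprime.dvd_of_dvd_pow h2
    obtain ⟨t, rfl⟩ := Polynomial.map_surjective ρ hρ t
    obtain ⟨r', hr'⟩ := hpoly (q - twistedPoly p b c g h * t) (by
      rw [Polynomial.map_sub, Polynomial.map_mul, hFmap, ht, sub_self])
    refine ⟨r', (isUnit_algebraMap_kummer hπ).mul_left_cancel ?_⟩
    rw [hq, sub_eq_iff_eq_add.1 hr', map_add, map_mul _ (twistedPoly p b c g h),
      aeval_twistedPoly hp hc hb hf hw, zero_mul, add_zero, map_mul, aeval_C]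
  have hpow : ∀ (n : ℕ) (x : AdjoinRoot (X ^ p - C (algebraMap A F f))), IsIntegral A x →
      ∀ q : A[X], algebraMap A _ π ^ n * x = aeval w q → ∃ r : A[X], x = aeval w r := by
    intro n
    induction n with
    | zero => exact fun x _ q hq => ⟨q, by simpa using hq⟩
    | succ n ih =>
      intro x hx q hq
      rw [pow_succ', mul_assoc] at hq
      obtain ⟨r, hr⟩ := hdesc _ ((isIntegral_algebraMap.pow n).mul hx) q hq
      exact ih x hx r hr
  intro x hx
  obtain ⟨q, hq⟩ := exists_natCast_mul_eq_aeval_root hp hζ hfu (show IsIntegral A x from hx)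
  obtain ⟨d, hd⟩ := hpe
  obtain ⟨r, hr⟩ := hpow e x hx (C d * q.comp (C c * X + C h)) (by
    rw [map_mul, aeval_comp, map_add, map_mul, aeval_C, aeval_C, aeval_X, aeval_C, hw,
      sub_add_cancel, ← hq, ← map_pow, hd, map_mul, map_natCast]
    ring)
  rw [hr]
  exact aeval_mem_adjoin_singleton A w

end Generator

section Residual

/-- A power series whose order is prime to `p` is not a `p`-th power in the field of fractions. -/
theorem prime_X_pow_sub_C_of_order {k : Type*} [Field k] {p : ℕ} (hp : p.Prime)
    {g : PowerSeries k} {m : ℕ} (hm : g.order = m) (hpm : ¬ p ∣ m) :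
    Prime (X ^ p - C g) := by
  refine Irreducible.prime ?_
  have hmon : (X ^ p - C g).Monic := monic_X_pow_sub_C _ hp.ne_zero
  rw [hmon.irreducible_iff_irreducible_map_fraction_map (K := FractionRing (PowerSeries k))]
  rw [Polynomial.map_sub, Polynomial.map_pow, map_X, map_C]
  refine X_pow_sub_C_irreducible_of_prime hp fun b hb => hpm ?_
  obtain ⟨x, y, hy, rfl⟩ := IsFractionRing.div_surjective (A := PowerSeries k) b
  have hy0 : y ≠ 0 := nonZeroDivisors.ne_zero hy
  have hy' : algebraMap (PowerSeries k) (FractionRing (PowerSeries k)) y ≠ 0 := by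
    rwa [Ne, FaithfulSMul.algebraMap_eq_zero_iff]
  rw [div_pow, div_eq_iff (pow_ne_zero _ hy'), ← map_pow, ← map_pow, ← map_mul] at hb
  have h1 := congrArg PowerSeries.order (FaithfulSMul.algebraMap_injective _ _ hb)
  have hx0 : x ≠ 0 := by
    rintro rfl
    have h2 := FaithfulSMul.algebraMap_injective _ _ hb
    rw [zero_pow hp.ne_zero, eq_comm, mul_eq_zero, or_iff_left (pow_ne_zero _ hy0)] at h2
    rw [h2, PowerSeries.order_zero] at hm
    exact ENat.natCast_ne_top _ hm.symm
  rw [PowerSeries.order_mul, hm, PowerSeries.order_pow, PowerSeries.order_pow] at h1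
  have hx' : x.order ≠ ⊤ := by rwa [Ne, PowerSeries.order_eq_top]
  have hy'' : y.order ≠ ⊤ := by rwa [Ne, PowerSeries.order_eq_top]
  lift x.order to ℕ using hx' with s
  lift y.order to ℕ using hy'' with n
  simp only [nsmul_eq_mul] at h1
  norm_cast at h1
  exact (Nat.dvd_add_left (dvd_mul_right p n)).1 (h1 ▸ dvd_mul_right p s)

end Residual

end PCyclic

/-! ### Recognizing an open disk -/

namespace PCyclic

open Polynomial

section OpenDisk

/-- `Polynomial.IsDistinguishedAt.algEquivQuotient` as a ring isomorphism. For
`S = R⟦t⟧` the `S`-algebra structure of `S⟦X⟧` used there is not the one found by instance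
search. -/
theorem exists_quotient_ringEquiv_of_isDistinguishedAt {S : Type*} [CommRing S] {I : Ideal S}
    [IsAdicComplete I S] {P : S[X]} (hP : P.IsDistinguishedAt I) :
    ∃ e : (S[X] ⧸ Ideal.span {P}) ≃+* (PowerSeries S ⧸ Ideal.span {(P : PowerSeries S)}),
      ∀ s, e (Ideal.Quotient.mk _ (C s)) = Ideal.Quotient.mk _ (PowerSeries.C s) :=
  ⟨hP.algEquivQuotient.toRingEquiv, fun s => hP.algEquivQuotient.commutes s⟩

variable {R : Type*} [CommRing R] [IsLocalRing R] [IsAdicComplete (IsLocalRing.maximalIdeal R) R]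

/-- Let `P ∈ R⟦t⟧[s]` be distinguished, with non-unit constant term and with unit coefficient at
`t`. By Weierstrass preparation `R⟦t⟧[s] / P = R⟦t⟧⟦s⟧ / P`, and after exchanging the variables `P`
is a unit times a linear polynomial in `t` over `R⟦s⟧`, so that the quotient is `R⟦s⟧`. -/
theorem exists_quotient_ringEquiv_powerSeries {P : (PowerSeries R)[X]}
    (hP : P.IsDistinguishedAt (IsLocalRing.maximalIdeal (PowerSeries R)))
    (h0 : PowerSeries.coeff 0 (P.coeff 0) ∈ IsLocalRing.maximalIdeal R)
    (h1 : IsUnit (PowerSeries.coeff 1 (P.coeff 0))) :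
    ∃ e : ((PowerSeries R)[X] ⧸ Ideal.span {P}) ≃+* PowerSeries R,
      ∀ r : R, e (Ideal.Quotient.mk _ (C (PowerSeries.C r))) = PowerSeries.C r := by
  set G : PowerSeries (PowerSeries R) := swapVars R (P : PowerSeries (PowerSeries R)) with hG
  have hcoef : ∀ i, PowerSeries.coeff 0 (PowerSeries.coeff i G) =
      PowerSeries.coeff i (P.coeff 0) := fun i => by
    rw [hG, coeff_coeff_swapVars, Polynomial.coeff_coe]
  have hmem : ∀ x : PowerSeries R, IsLocalRing.residue (PowerSeries R) x = 0 ↔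
      PowerSeries.coeff 0 x ∈ IsLocalRing.maximalIdeal R := fun x => by
    rw [IsLocalRing.residue_eq_zero_iff, maximalIdeal_eq_adicIdeal]
    simp [adicIdeal]
  have hord : (G.map (IsLocalRing.residue (PowerSeries R))).order = (1 : ℕ) := by
    rw [PowerSeries.order_eq_nat]
    constructor
    · rw [PowerSeries.coeff_map, Ne, hmem, hcoef, IsLocalRing.mem_maximalIdeal]
      exact fun h => h h1
    · intro i hi
      obtain rfl : i = 0 := by omega
      rw [PowerSeries.coeff_map, hmem, hcoef]
      exact h0
  have hG0 : G.map (IsLocalRing.residue (PowerSeries R)) ≠ 0 := by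
    intro h
    rw [h, PowerSeries.order_zero] at hord
    exact ENat.natCast_ne_top _ hord.symm
  obtain ⟨Q, u, hQ⟩ := PowerSeries.exists_isWeierstrassFactorization hG0
  have hdeg : Q.natDegree = 1 := by
    rw [hQ.natDegree_eq_toNat_order_map, hord]
    rfl
  have hlin : Q = X - C (-(Q.coeff 0)) := by
    rw [C_neg, sub_neg_eq_add]
    exact hQ.isDistinguishedAt.monic.eq_X_add_C hdeg
  obtain ⟨e₁, k₁⟩ := exists_quotient_ringEquiv_of_isDistinguishedAt hP
  obtain ⟨e₃, k₃⟩ := exists_quotient_ringEquiv_of_isDistinguishedAt hQ.isDistinguishedAt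
  let e₂ : (PowerSeries (PowerSeries R) ⧸ Ideal.span {(P : PowerSeries (PowerSeries R))}) ≃+*
      (PowerSeries (PowerSeries R) ⧸ Ideal.span {(Q : PowerSeries (PowerSeries R))}) :=
    Ideal.quotientEquiv _ _ (swapVars R) (by
      rw [Ideal.map_span, Set.image_singleton]
      change _ = Ideal.span {G}
      rw [hQ.eq_mul, Ideal.span_singleton_mul_right_unit hQ.isUnit])
  let e₄ := (Ideal.quotientEquivAlgOfEq (PowerSeries R)
    (congrArg (fun q => Ideal.span {q}) hlin)).trans (quotientSpanXSubCAlgEquiv (-(Q.coeff 0)))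
  refine ⟨e₁.trans (e₂.trans (e₃.symm.trans e₄.toRingEquiv)), fun r => ?_⟩
  have k₂ : e₂ (Ideal.Quotient.mk _ (PowerSeries.C (PowerSeries.C r))) =
      Ideal.Quotient.mk _ (PowerSeries.C (PowerSeries.C r)) := by
    rw [Ideal.quotientEquiv_mk, swapVars_C_C]
  change e₄ (e₃.symm (e₂ (e₁ _))) = _
  rw [k₁, k₂, ← k₃, RingEquiv.symm_apply_apply]
  exact e₄.commutes (PowerSeries.C r)

end OpenDisk

end PCyclic

/-! ### Divisibility by a uniformizer and reduction -/

namespace PCyclic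

open Polynomial

section Divisibility

variable {A : Type*} [CommRing A] [IsDomain A] {p : ℕ} {t : A}

/-- If `p` is divisible by `t ^ (j (p - 1) + 1)`, then a congruence of `p`-th powers modulo
`t ^ (p j)` comes from a congruence modulo `t ^ j`. -/
theorem pow_dvd_sub_of_pow_dvd_pow_sub_pow (hp : p.Prime) (ht : Prime t) {j : ℕ}
    (hpj : t ^ (j * (p - 1) + 1) ∣ (p : A)) {h h' : A} (hd : t ^ (p * j) ∣ h' ^ p - h ^ p) :
    t ^ j ∣ h' - h := by
  have key : ∀ i ≤ j, t ^ i ∣ h' - h := by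
    intro i
    induction i with
    | zero => simp
    | succ i ih =>
      intro hij
      obtain ⟨d, hd'⟩ := ih (by omega)
      obtain ⟨r, hr⟩ := exists_add_pow_prime_eq hp h (t ^ i * d)
      rw [← hd', add_sub_cancel, hd'] at hr
      have h1 : t ^ (p * i + 1) ∣ h' ^ p - h ^ p := (pow_dvd_pow t (by nlinarith [hp.pos])).trans hd
      have hexp : p * i + 1 ≤ (j * (p - 1) + 1) + i := by
        obtain ⟨m, rfl⟩ : ∃ m, p = m + 1 := ⟨p - 1, by have := hp.pos; omega⟩
        rw [Nat.add_sub_cancel]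
        nlinarith
      have h2 : t ^ (p * i + 1) ∣ (p : A) * h * (t ^ i * d) * r := by
        refine (pow_dvd_pow t hexp).trans ?_
        rw [pow_add t _ i, show (p : A) * h * (t ^ i * d) * r = (p * t ^ i) * (h * d * r) by ring]
        exact (mul_dvd_mul_right hpj _).mul_right _
      have h3 : t ^ (p * i) * t ∣ t ^ (p * i) * d ^ p := by
        have : t ^ (p * i) * d ^ p = h' ^ p - h ^ p - (p : A) * h * (t ^ i * d) * r := by
          rw [hr]; ring
        rw [this, ← pow_succ]
        exact dvd_sub h1 h2
      have h4 := ht.dvd_of_dvd_pow ((mul_dvd_mul_iff_left (pow_ne_zero _ ht.ne_zero)).1 h3)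
      rw [hd', pow_succ]
      exact mul_dvd_mul_left _ h4
  exact key j le_rfl

end Divisibility

section RootsOfUnity

theorem associated_natCast_sub_one_pow {R : Type*} [CommRing R] [IsDomain R] {p : ℕ}
    (hp : p.Prime) {ζ : R} (hζ : IsPrimitiveRoot ζ p) :
    Associated (p : R) ((ζ - 1) ^ (p - 1)) := by
  have : Fact p.Prime := ⟨hp⟩
  have : NeZero p := ⟨hp.ne_zero⟩
  have h1 := congrArg (eval 1) (cyclotomic_eq_prod_X_sub_primitiveRoots hζ)
  rw [eval_one_cyclotomic_prime, eval_prod] at h1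
  rw [h1, ← Nat.totient_prime hp, ← hζ.card_primitiveRoots, ← Finset.prod_const]
  refine Associated.prod _ _ _ fun μ hμ => ?_
  obtain ⟨i, -, hi, rfl⟩ := (hζ.isPrimitiveRoot_iff).1 (isPrimitiveRoot_of_mem_primitiveRoots hμ)
  rw [eval_sub, eval_X, eval_C, ← neg_sub]
  exact (hζ.associated_sub_one_pow_sub_one_of_coprime hi).symm.neg_left

end RootsOfUnity

section Reduction

variable {R : Type*} [CommRing R]

theorem C_dvd_powerSeries_iff {a : R} {g : PowerSeries R} :
    PowerSeries.C a ∣ g ↔ ∀ i, a ∣ PowerSeries.coeff i g := by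
  refine ⟨fun ⟨r, hr⟩ i => ⟨PowerSeries.coeff i r, by rw [hr, PowerSeries.coeff_C_mul]⟩,
    fun h => ?_⟩
  choose r hr using h
  exact ⟨PowerSeries.mk r, by ext i; rw [PowerSeries.coeff_C_mul, PowerSeries.coeff_mk, hr]⟩

variable [IsLocalRing R]

/-- The reduction `R⟦t⟧ → k⟦t⟧` modulo the maximal ideal of `R`. -/
noncomputable abbrev reduction (R : Type*) [CommRing R] [IsLocalRing R] :
    PowerSeries R →+* PowerSeries (IsLocalRing.ResidueField R) :=
  PowerSeries.map (IsLocalRing.residue R)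

theorem reduction_surjective : Function.Surjective (reduction R) :=
  PowerSeries.map_surjective _ IsLocalRing.residue_surjective

instance isAlgClosed_residueField_powerSeries [IsAlgClosed (IsLocalRing.ResidueField R)] :
    IsAlgClosed (IsLocalRing.ResidueField (PowerSeries R)) := by
  let φ : PowerSeries R →+* IsLocalRing.ResidueField R :=
    (IsLocalRing.residue R).comp (PowerSeries.constantCoeff (R := R))
  have hφ : Function.Surjective φ :=
    IsLocalRing.residue_surjective.comp PowerSeries.constantCoeff_surj
  have e : (PowerSeries R ⧸ RingHom.ker φ) ≃+* IsLocalRing.ResidueField R :=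
    RingHom.quotientKerEquivOfSurjective hφ
  rw [IsLocalRing.ker_eq_maximalIdeal φ hφ] at e
  exact IsAlgClosed.of_ringEquiv _ _ e.symm

end Reduction

section DiscreteValuationRing

variable {R : Type*} [CommRing R] [IsDomain R] [IsDiscreteValuationRing R]

theorem reduction_eq_zero_iff {ϖ : R} (hϖ : Irreducible ϖ) {g : PowerSeries R} :
    reduction R g = 0 ↔ PowerSeries.C ϖ ∣ g := by
  rw [C_dvd_powerSeries_iff, PowerSeries.ext_iff]
  refine forall_congr' fun i => ?_
  rw [PowerSeries.coeff_map, map_zero, IsLocalRing.residue_eq_zero_iff,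
    hϖ.maximalIdeal_eq, Ideal.mem_span_singleton]

theorem prime_C {ϖ : R} (hϖ : Irreducible ϖ) : Prime (PowerSeries.C ϖ) := by
  refine ⟨fun h => hϖ.ne_zero (PowerSeries.C_injective (h.trans (map_zero _).symm)), fun h => ?_,
    fun a b hab => ?_⟩
  · rw [PowerSeries.isUnit_iff_constantCoeff] at h
    exact hϖ.not_isUnit (by simpa using h)
  · simp only [← reduction_eq_zero_iff hϖ] at hab ⊢
    rw [map_mul] at hab
    exact mul_eq_zero.1 hab

theorem exists_eq_C_pow_mul {ϖ : R} (hϖ : Irreducible ϖ) {g : PowerSeries R} (hg : g ≠ 0) :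
    ∃ (n : ℕ) (g' : PowerSeries R), g = PowerSeries.C ϖ ^ n * g' ∧ reduction R g' ≠ 0 := by
  obtain ⟨g', hg', h⟩ :=
    (FiniteMultiplicity.of_prime_left (prime_C hϖ) hg).exists_eq_pow_mul_and_not_dvd
  exact ⟨_, g', hg', by rwa [Ne, reduction_eq_zero_iff hϖ]⟩

end DiscreteValuationRing

end PCyclic

/-! ### Best approximation by `p`-th powers over a discrete valuation ring -/

namespace PCyclic

open Polynomial

section DVR

variable {R : Type*} [CommRing R] [IsDomain R] {p : ℕ} {ϖ ζ : R} {l : ℕ}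

/-- `p = (ϖ ^ j) ^ (p - 1) b` with `b` divisible by `ϖ` if `ϖ ^ j` has smaller valuation than
`ζ - 1`. -/
theorem exists_natCast_eq_C_pow_mul (hp : p.Prime) (hζ : IsPrimitiveRoot ζ p)
    (hl : Associated (ζ - 1) (ϖ ^ l)) {j : ℕ} (hj : j < l) :
    ∃ b : PowerSeries R, (p : PowerSeries R) = (PowerSeries.C ϖ ^ j) ^ (p - 1) *
      (PowerSeries.C ϖ * b) := by
  have h1 : ϖ ^ (j * (p - 1) + 1) ∣ (p : R) := by
    refine Dvd.dvd.trans ?_ ((associated_natCast_sub_one_pow hp hζ).trans (hl.pow_pow)).symm.dvd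
    rw [← pow_mul]
    refine pow_dvd_pow _ ?_
    have := hp.two_le
    obtain ⟨m, rfl⟩ : ∃ m, p = m + 2 := ⟨p - 2, by omega⟩
    simp only [show m + 2 - 1 = m + 1 by omega]
    nlinarith
  obtain ⟨b, hb⟩ := h1
  refine ⟨PowerSeries.C b, ?_⟩
  rw [← map_natCast (PowerSeries.C (R := R)), hb]
  simp only [map_mul, map_pow]
  ring

theorem natCast_dvd_C_pow (hp : p.Prime) (hζ : IsPrimitiveRoot ζ p)
    (hl : Associated (ζ - 1) (ϖ ^ l)) :
    (p : PowerSeries R) ∣ PowerSeries.C ϖ ^ (l * (p - 1)) := by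
  have h1 := ((associated_natCast_sub_one_pow hp hζ).trans (hl.pow_pow)).dvd
  rw [← map_natCast (PowerSeries.C (R := R)), ← map_pow, pow_mul]
  exact _root_.map_dvd PowerSeries.C h1

variable [IsDiscreteValuationRing R]

/-- A `p`-th power of a unit approximates `f` to a precision below `p v(ζ - 1) = p / (p - 1)`,
unless `f` is itself a `p`-th power. -/
theorem not_pow_dvd_sub_pow [IsAdicComplete (IsLocalRing.maximalIdeal R) R]
    [IsAlgClosed (IsLocalRing.ResidueField R)] (hp : p.Prime)
    (hpm : (p : R) ∈ IsLocalRing.maximalIdeal R) (hζ : IsPrimitiveRoot ζ p)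
    (hl : Associated (ζ - 1) (ϖ ^ l)) {f h : PowerSeries R} (hf : ¬ ∃ y, y ^ p = f)
    (hh : IsUnit h) : ¬ PowerSeries.C ϖ ^ (p * l) ∣ f - h ^ p := by
  intro hd
  have hass := associated_natCast_sub_one_pow hp hζ
  have hζm : ζ - 1 ∈ IsLocalRing.maximalIdeal R :=
    (IsLocalRing.maximalIdeal.isMaximal R).isPrime.mem_of_pow_mem _
      (Ideal.mem_of_dvd _ hass.dvd hpm)
  have h1 : (PowerSeries.C (ζ - 1)) ^ p ∣ f - h ^ p := by
    refine Dvd.dvd.trans ?_ hd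
    rw [← map_pow, ← map_pow, mul_comm, pow_mul]
    exact _root_.map_dvd PowerSeries.C (hl.pow_pow).dvd
  obtain ⟨g, hg⟩ := h1
  obtain ⟨u, hu⟩ := hass.symm
  have : HenselianLocalRing (PowerSeries R) :=
    { is_henselian := fun f hf a h1 h2 =>
        HenselianRing.is_henselian (I := IsLocalRing.maximalIdeal (PowerSeries R)) f hf a h1
          (h2.map _) }
  refine hf (exists_pow_eq_of_henselian (PowerSeries.C (u : R)) g h hp (l := PowerSeries.C (ζ - 1))
    ?_ (u.isUnit.map _) ?_ hh (sub_eq_iff_eq_add'.1 hg))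
  · rw [maximalIdeal_eq_adicIdeal]
    simpa [adicIdeal] using hζm
  · rw [← map_pow, ← map_mul, hu, map_natCast]

variable {F : Type*} [Field F] [Algebra (PowerSeries R) F] [IsFractionRing (PowerSeries R) F]
  {f : PowerSeries R}

/-- `B = A[w]` for `w = (y - h) / c` as soon as `(f - h ^ p) / c ^ p` has a reduction of order prime
to `p` and `c` has valuation less than `1 / (p - 1)`. -/
theorem integralClosure_eq_adjoin_of_order (hp : p.Prime) (hϖ : Irreducible ϖ)
    (hζ : IsPrimitiveRoot ζ p) (hl : Associated (ζ - 1) (ϖ ^ l)) (hfu : IsUnit f)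
    {b c g h : PowerSeries R} (hc : c ≠ 0) (hb : (p : PowerSeries R) = c ^ (p - 1) * b)
    (hb0 : reduction R b = 0) (hf : f = h ^ p + c ^ p * g) {m : ℕ}
    (hm : (reduction R g).order = m) (hpm : ¬ p ∣ m)
    {w : AdjoinRoot (X ^ p - C (algebraMap (PowerSeries R) F f))}
    (hw : algebraMap (PowerSeries R) _ c * w =
      AdjoinRoot.root _ - algebraMap (PowerSeries R) _ h) :
    integralClosure (PowerSeries R) (AdjoinRoot (X ^ p - C (algebraMap (PowerSeries R) F f))) =
      Algebra.adjoin (PowerSeries R) {w} :=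
  integralClosure_eq_adjoin hp (hζ.map_of_injective (f := PowerSeries.C) PowerSeries.C_injective)
    hfu hc hb hf hw (prime_C hϖ).ne_zero (natCast_dvd_C_pow hp hζ hl) (reduction R)
    reduction_surjective (fun _ => reduction_eq_zero_iff hϖ) hb0
    (prime_X_pow_sub_C_of_order hp hm hpm)

/-- If the order `m` of `g` modulo `ϖ` is `1`, then the integral closure is a ring of power series
over `R`. -/
theorem exists_integralClosure_ringEquiv_powerSeries
    [IsAdicComplete (IsLocalRing.maximalIdeal R) R] (hp : p.Prime) (hϖ : Irreducible ϖ)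
    (hζ : IsPrimitiveRoot ζ p) (hl : Associated (ζ - 1) (ϖ ^ l)) (hfu : IsUnit f)
    {b c g h : PowerSeries R} (hc : c ≠ 0) (hb : (p : PowerSeries R) = c ^ (p - 1) * b)
    (hb0 : reduction R b = 0) (hf : f = h ^ p + c ^ p * g)
    (hm : (reduction R g).order = (1 : ℕ)) :
    ∃ e : integralClosure (PowerSeries R)
        (AdjoinRoot (X ^ p - C (algebraMap (PowerSeries R) F f))) ≃+* PowerSeries R,
      ∀ r : R, e (algebraMap (PowerSeries R) _ (PowerSeries.C r)) = PowerSeries.C r := by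
  have hcu := isUnit_algebraMap_kummer (F := F) (p := p) (f := f) hc
  obtain ⟨w, hw⟩ := hcu.dvd (a := AdjoinRoot.root (X ^ p - C (algebraMap (PowerSeries R) F f)) -
    algebraMap (PowerSeries R) _ h)
  rw [eq_comm] at hw
  have hB := integralClosure_eq_adjoin_of_order hp hϖ hζ hl hfu hc hb hb0 hf hm
    (by rw [Nat.dvd_one]; exact hp.ne_one) hw
  have hwB : w ∈ integralClosure (PowerSeries R)
      (AdjoinRoot (X ^ p - C (algebraMap (PowerSeries R) F f))) := by
    rw [hB]; exact Algebra.self_mem_adjoin_singleton _ _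
  set P := twistedPoly p b c g h with hP
  obtain ⟨hmon, hdeg⟩ := twistedPoly_monic_and_natDegree b c g h hp
  let φ : (PowerSeries R)[X] →ₐ[PowerSeries R] integralClosure (PowerSeries R)
      (AdjoinRoot (X ^ p - C (algebraMap (PowerSeries R) F f))) := aeval ⟨w, hwB⟩
  have hφ : ∀ q, ((φ q : integralClosure (PowerSeries R) _) :
      AdjoinRoot (X ^ p - C (algebraMap (PowerSeries R) F f))) = aeval w q := fun q => by
    exact (aeval_algHom_apply (integralClosure (PowerSeries R)
      (AdjoinRoot (X ^ p - C (algebraMap (PowerSeries R) F f)))).val ⟨w, hwB⟩ q).symm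
  have hsurj : Function.Surjective φ := by
    rintro ⟨x, hx⟩
    have hx' := hx
    rw [hB, Algebra.adjoin_singleton_eq_range_aeval] at hx'
    obtain ⟨q, hq⟩ := hx'
    exact ⟨q, Subtype.ext ((hφ q).trans hq)⟩
  have hker : RingHom.ker φ = Ideal.span {P} := by
    ext q
    rw [RingHom.mem_ker, Ideal.mem_span_singleton,
      ← aeval_eq_zero_iff_twistedPoly_dvd hp hc hb hf hw, ← hφ]
    exact Subtype.ext_iff
  obtain ⟨hg1, hg0⟩ := PowerSeries.order_eq_nat.1 hm
  rw [PowerSeries.coeff_map] at hg1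
  have hg0 := hg0 0 one_pos
  rw [PowerSeries.coeff_map, IsLocalRing.residue_eq_zero_iff] at hg0
  have hmem : ∀ x : PowerSeries R, PowerSeries.coeff 0 x ∈ IsLocalRing.maximalIdeal R →
      IsLocalRing.residue (PowerSeries R) x = 0 := fun x hx => by
    rw [IsLocalRing.residue_eq_zero_iff, maximalIdeal_eq_adicIdeal]
    simpa [adicIdeal] using hx
  have hdist : P.IsDistinguishedAt (IsLocalRing.maximalIdeal (PowerSeries R)) := by
    refine { mem := fun {n} hn => ?_, monic := hmon }
    have hb0' : PowerSeries.coeff 0 b ∈ IsLocalRing.maximalIdeal R := by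
      rw [← IsLocalRing.residue_eq_zero_iff, ← PowerSeries.coeff_map, hb0, map_zero]
    have h1 := congrArg (coeff · n)
      (map_twistedPoly (p := p) b c g h (IsLocalRing.residue (PowerSeries R)))
    rw [hmem b hb0', hmem g hg0, twistedPoly_zero_left, coeff_map, C_0, sub_zero, coeff_X_pow,
      if_neg (hn.trans_eq hdeg).ne] at h1
    exact (IsLocalRing.residue_eq_zero_iff _).1 h1
  have hP0 : P.coeff 0 = -g := by
    rw [hP, twistedPoly, coeff_sub, coeff_add, coeff_C_mul, middlePoly_coeff_zero, coeff_C_zero,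
      coeff_X_pow, if_neg hp.ne_zero.symm]
    ring
  obtain ⟨e, he⟩ := exists_quotient_ringEquiv_powerSeries hdist
    (by rw [hP0, map_neg]; exact neg_mem hg0)
    (by
      rw [hP0, map_neg, IsUnit.neg_iff]
      rw [Ne, IsLocalRing.residue_eq_zero_iff, IsLocalRing.mem_maximalIdeal, mem_nonunits_iff,
        not_not] at hg1
      exact hg1)
  let e' := (Ideal.quotientEquivAlgOfEq (PowerSeries R) hker.symm).trans
    (Ideal.quotientKerAlgEquivOfSurjective hsurj)
  refine ⟨e'.symm.toRingEquiv.trans e, fun r => ?_⟩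
  change e (e'.symm _) = _
  rw [e'.symm.commutes]
  exact he r

/-- Reducedness of the special fibre, here `hred`, forces the exact exponent `n` of `ϖ` in
`f - h ^ p` to be a multiple of `p`: with `j` the integral part of `n / p`, the element `w = (y - h) / ϖ ^ j` is
integral, and unless `p j = n` its power `w ^ p` is divisible by `ϖ`; then `w / ϖ` is integral, and
its norm shows that `f - h ^ p` is divisible by `ϖ ^ (p (j + 1))`. -/
theorem dvd_of_reduced (hp : p.Prime) (hϖ : Irreducible ϖ)
    (hζ : IsPrimitiveRoot ζ p) (hl : Associated (ζ - 1) (ϖ ^ l))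
    (hred : ∀ x x' : AdjoinRoot (X ^ p - C (algebraMap (PowerSeries R) F f)),
      IsIntegral (PowerSeries R) x → IsIntegral (PowerSeries R) x' →
      x ^ p = algebraMap (PowerSeries R) _ (PowerSeries.C ϖ) * x' →
      ∃ x'', IsIntegral (PowerSeries R) x'' ∧
        x = algebraMap (PowerSeries R) _ (PowerSeries.C ϖ) * x'')
    {n : ℕ} (hn : n < p * l) {h : PowerSeries R} (hd : PowerSeries.C ϖ ^ n ∣ f - h ^ p)
    (hd' : ¬ PowerSeries.C ϖ ^ (n + 1) ∣ f - h ^ p) : p ∣ n := by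
  by_contra hpn
  set t : PowerSeries R := PowerSeries.C ϖ with ht
  have ht0 : t ≠ 0 := (prime_C hϖ).ne_zero
  have hdiv := Nat.div_add_mod n p
  have hmod := Nat.mod_lt n hp.pos
  have hmod0 : 0 < n % p := Nat.pos_of_ne_zero fun h0 => hpn (Nat.dvd_of_mod_eq_zero h0)
  obtain ⟨j, hj⟩ : ∃ j, j = n / p := ⟨_, rfl⟩
  rw [← hj] at hdiv
  have hjl : j < l := lt_of_mul_lt_mul_left (by omega : p * j < p * l) (Nat.zero_le _)
  obtain ⟨g, hg⟩ : t ^ (p * j + 1) ∣ f - h ^ p := (pow_dvd_pow t (by omega)).trans hd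
  obtain ⟨b, hb⟩ := exists_natCast_eq_C_pow_mul hp hζ hl hjl
  have hf : f = h ^ p + (t ^ j) ^ p * (t * g) := by
    rw [← sub_eq_iff_eq_add', hg]; ring
  have hc : t ^ j ≠ 0 := pow_ne_zero _ ht0
  have hcu := isUnit_algebraMap_kummer (F := F) (p := p) (f := f) hc
  obtain ⟨w, hw⟩ := hcu.dvd (a := AdjoinRoot.root (X ^ p - C (algebraMap (PowerSeries R) F f)) -
    algebraMap (PowerSeries R) _ h)
  rw [eq_comm] at hw
  have hroot := aeval_twistedPoly hp hc hb hf hw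
  have hwint : IsIntegral (PowerSeries R) w :=
    ⟨_, (twistedPoly_monic_and_natDegree _ _ _ _ hp).1, by rw [← aeval_def]; exact hroot⟩
  obtain ⟨w', hw', hww'⟩ := hred w (algebraMap (PowerSeries R) _ g -
      algebraMap (PowerSeries R) _ b * aeval w (middlePoly p (t ^ j) h)) hwint
    (isIntegral_algebraMap.sub (isIntegral_algebraMap.mul
      (adjoin_le_integralClosure hwint (aeval_mem_adjoin_singleton _ w)))) (by
      rw [twistedPoly, map_sub, map_add, map_mul, map_pow, aeval_X, aeval_C, aeval_C, map_mul,
        map_mul] at hroot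
      linear_combination hroot)
  have h1 := pow_dvd_of_isIntegral hp
    (hζ.map_of_injective (f := PowerSeries.C) PowerSeries.C_injective)
    (pow_ne_zero (j + 1) ht0) hw' (h := h) (by
      rw [← hw, hww', pow_succ, map_mul, mul_assoc])
  rw [← pow_mul] at h1
  refine hd' ((pow_dvd_pow t ?_).trans h1)
  rw [mul_comm, mul_add]
  omega

/-- The shape of the best approximations of `f` by `p`-th powers of units, in terms of divisibility
by the uniformizer `ϖ` and of orders of reductions modulo `ϖ`. -/
theorem exists_best_approximation [IsAdicComplete (IsLocalRing.maximalIdeal R) R]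
    [IsAlgClosed (IsLocalRing.ResidueField R)] (hp : p.Prime)
    (hpm : (p : R) ∈ IsLocalRing.maximalIdeal R) (hϖ : Irreducible ϖ)
    (hζ : IsPrimitiveRoot ζ p) (hl : Associated (ζ - 1) (ϖ ^ l)) (hfu : IsUnit f)
    (hf : ¬ ∃ y, y ^ p = f)
    (hred : ∀ x x' : AdjoinRoot (X ^ p - C (algebraMap (PowerSeries R) F f)),
      IsIntegral (PowerSeries R) x → IsIntegral (PowerSeries R) x' →
      x ^ p = algebraMap (PowerSeries R) _ (PowerSeries.C ϖ) * x' →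
      ∃ x'', IsIntegral (PowerSeries R) x'' ∧
        x = algebraMap (PowerSeries R) _ (PowerSeries.C ϖ) * x'') :
    ∃ j m : ℕ, j < l ∧ ¬ p ∣ m ∧
      (∃ h g : PowerSeries R, IsUnit h ∧ f = h ^ p + (PowerSeries.C ϖ ^ j) ^ p * g ∧
        (reduction R g).order = m) ∧
      ∀ h g : PowerSeries R, ∀ n : ℕ, IsUnit h → f = h ^ p + PowerSeries.C ϖ ^ n * g →
        n < p * j ∨ n = p * j ∧ (reduction R g).order ≤ m := by
  classical
  have : CharP (IsLocalRing.ResidueField R) p := by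
    rw [CharP.charP_iff_prime_eq_zero hp, ← map_natCast (IsLocalRing.residue R),
      IsLocalRing.residue_eq_zero_iff]
    exact hpm
  set t : PowerSeries R := PowerSeries.C ϖ with ht
  have htp : Prime t := prime_C hϖ
  have hbound : ∀ n, (∃ h, IsUnit h ∧ t ^ n ∣ f - h ^ p) → n < p * l := by
    rintro n ⟨h, hh, hd⟩
    by_contra! hle
    exact not_pow_dvd_sub_pow hp hpm hζ hl hf hh ((pow_dvd_pow t hle).trans hd)
  obtain ⟨N, ⟨h, hh, hd⟩, hmax⟩ : ∃ N, (∃ h, IsUnit h ∧ t ^ N ∣ f - h ^ p) ∧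
      ∀ n, (∃ h, IsUnit h ∧ t ^ n ∣ f - h ^ p) → n ≤ N :=
    ⟨Nat.findGreatest (fun n => ∃ h, IsUnit h ∧ t ^ n ∣ f - h ^ p) (p * l),
      Nat.findGreatest_spec (P := fun n => ∃ h, IsUnit h ∧ t ^ n ∣ f - h ^ p) (Nat.zero_le _)
        ⟨1, isUnit_one, by simp⟩,
      fun n hn => Nat.le_findGreatest (hbound n hn).le hn⟩
  have hN : N < p * l := hbound N ⟨h, hh, hd⟩
  obtain ⟨j, rfl⟩ := dvd_of_reduced hp hϖ hζ hl hred hN hd fun hd' => by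
    have := hmax _ ⟨h, hh, hd'⟩
    omega
  have hjl : j < l := lt_of_mul_lt_mul_left hN (Nat.zero_le _)
  obtain ⟨b, hb⟩ := exists_natCast_eq_C_pow_mul hp hζ hl hjl
  have hpj : t ^ (j * (p - 1) + 1) ∣ (p : PowerSeries R) := ⟨b, by rw [hb]; ring⟩
  obtain ⟨g, hg⟩ := hd
  -- replacing `h` by `h + ϖ ^ j q` changes `g` by a `p`-th power modulo `ϖ`
  have hshift : ∀ q h g : PowerSeries R, f - h ^ p = t ^ (p * j) * g →
      ∃ s, f - (h + t ^ j * q) ^ p = t ^ (p * j) * (g - q ^ p - t * s) := by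
    intro q h g hg
    obtain ⟨r, hr⟩ := exists_add_pow_prime_eq hp h (t ^ j * q)
    refine ⟨b * h * q * r, ?_⟩
    have e₁ : (t ^ j) ^ (p - 1) * t ^ j = t ^ (p * j) := by
      rw [← pow_succ, Nat.sub_add_cancel hp.one_le, ← pow_mul, mul_comm]
    rw [hr, hb, mul_sub, mul_sub, ← hg, ← e₁, mul_pow, ← pow_mul, mul_comm j p, ← e₁]
    ring
  -- removing the exponents divisible by `p` gives a reduction whose order `m` is prime to `p`
  obtain ⟨q', hq'⟩ := exists_coeff_sub_pow hp (reduction R g)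
  obtain ⟨q, rfl⟩ := reduction_surjective q'
  obtain ⟨s, hs⟩ := hshift q h g hg
  set h₁ := h + t ^ j * q with hh₁
  set g₁ := g - q ^ p - t * s with hg₁
  have hred₁ : reduction R g₁ = reduction R g - reduction R q ^ p := by
    rw [hg₁, map_sub, map_sub, map_mul, map_pow, (reduction_eq_zero_iff hϖ).2 dvd_rfl, zero_mul,
      sub_zero]
  rw [← hred₁] at hq'
  have hunit : IsUnit h₁ := by
    -- for `j = 0` the unit `h` is changed modulo `ϖ`, but `h₁ ^ p` stays congruent to the unit `f`
    -- modulo the maximal ideal, the exponent `0` being divisible by `p`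
    have h0 := hq' 0 (dvd_zero p)
    rw [PowerSeries.coeff_map, IsLocalRing.residue_eq_zero_iff] at h0
    have h1 : f - h₁ ^ p ∈ IsLocalRing.maximalIdeal (PowerSeries R) := by
      rw [hs]
      refine Ideal.mul_mem_left _ _ ?_
      rw [maximalIdeal_eq_adicIdeal]
      simpa [adicIdeal] using h0
    by_contra h2
    have h3 : h₁ ∈ IsLocalRing.maximalIdeal (PowerSeries R) := (IsLocalRing.mem_maximalIdeal _).2 h2
    have h4 := add_mem h1 (Ideal.pow_mem_of_mem _ h3 p hp.pos)
    rw [sub_add_cancel] at h4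
    exact (IsLocalRing.mem_maximalIdeal _).1 h4 hfu
  have hne : (reduction R g₁).order ≠ ⊤ := by
    rw [Ne, PowerSeries.order_eq_top, reduction_eq_zero_iff hϖ]
    intro hdvd
    have := hmax (p * j + 1) ⟨h₁, hunit, by rw [hs, pow_succ]; exact mul_dvd_mul_left _ hdvd⟩
    omega
  obtain ⟨m, hm⟩ := ENat.ne_top_iff_exists.1 hne
  have hcm := (PowerSeries.order_eq_nat.1 hm.symm).1
  have hpm' : ¬ p ∣ m := fun hdvd => hcm (hq' m hdvd)
  refine ⟨j, m, hjl, hpm', ⟨h₁, g₁, hunit, ?_, hm.symm⟩, fun h' g' n hh' hf' => ?_⟩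
  · rw [← pow_mul, mul_comm j p, ← hs]; ring
  -- the coefficient at `m` is not affected by subtracting another `p`-th power
  · have hf'' : f - h' ^ p = t ^ n * g' := by rw [hf']; ring
    have hle := hmax n ⟨h', hh', Dvd.intro _ hf''.symm⟩
    refine hle.lt_or_eq.imp_right fun hn => ⟨hn, ?_⟩
    rw [hn] at hf''
    have hd : t ^ (p * j) ∣ h' ^ p - h₁ ^ p :=
      ⟨g₁ - g', by rw [mul_sub, ← hs, ← hf'']; ring⟩
    obtain ⟨q₂, hq₂⟩ := pow_dvd_sub_of_pow_dvd_pow_sub_pow hp htp hpj hd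
    obtain ⟨s₂, hs₂⟩ := hshift q₂ h₁ g₁ hs
    rw [← hq₂, add_sub_cancel, hf''] at hs₂
    have hg' := mul_left_cancel₀ (pow_ne_zero _ htp.ne_zero) hs₂
    refine PowerSeries.order_le m ?_
    rw [hg', map_sub (reduction R), map_sub (reduction R), map_mul, map_pow,
      (reduction_eq_zero_iff hϖ).2 dvd_rfl, zero_mul, sub_zero, map_sub, coeff_pow_char hp, if_neg hpm', sub_zero]
    exact hcm

end DVR

end PCyclic

/-! ### The valuation of rank two -/

namespace PCyclic

section Valuation

variable {K : Type*} [Field K] (v : AddValuation K (WithTop ℚ))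

theorem isUnit_valRing_iff (a : valRing v) : IsUnit a ↔ v (a : K) = 0 := by
  have ha : 0 ≤ v (a : K) := a.2
  constructor
  · rintro ⟨u, rfl⟩
    have h1 : 0 ≤ v ((u⁻¹ : (valRing v)ˣ) : K) := (u⁻¹ : (valRing v)ˣ).1.2
    have h2 : v ((u : valRing v) : K) + v ((u⁻¹ : (valRing v)ˣ) : K) = 0 := by
      rw [← v.map_mul]
      have : ((u : valRing v) : K) * ((u⁻¹ : (valRing v)ˣ) : K) = 1 := by
        have := congrArg (Subtype.val) u.mul_inv
        exact this
      rw [this, v.map_one]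
    exact le_antisymm (h2 ▸ le_add_of_nonneg_right h1) ha
  · intro h
    have h0 : (a : K) ≠ 0 := by
      intro h0
      rw [h0, v.map_zero] at h
      exact WithTop.top_ne_zero h
    have h1 : v (a : K)⁻¹ = 0 := by
      have := v.map_mul (a : K) (a : K)⁻¹
      rw [mul_inv_cancel₀ h0, v.map_one, h, zero_add] at this
      exact this.symm
    exact IsUnit.of_mul_eq_one ⟨(a : K)⁻¹, (mem_valRing v _).2 h1.ge⟩
      (Subtype.ext (mul_inv_cancel₀ h0))

theorem residue_valRing_eq_zero_iff (a : valRing v) :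
    IsLocalRing.residue (valRing v) a = 0 ↔ 0 < v (a : K) := by
  rw [IsLocalRing.residue_eq_zero_iff, IsLocalRing.mem_maximalIdeal, mem_nonunits_iff,
    isUnit_valRing_iff]
  exact ⟨fun h => lt_of_le_of_ne a.2 (Ne.symm h), fun h => h.ne'⟩

variable {v}

/-- `v_η g = (μ, m)` if and only if `g = a g'`, where `a` is a constant of valuation `μ` and the
reduction of `g'` has order `m`. -/
theorem vEta_eq_coe_iff_exists {a : valRing v} {μ : ℚ} (ha : v (a : K) = (μ : WithTop ℚ))
    (g : Disk v) (m : ℕ) :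
    vEta v g = ((toLex (μ, (m : ℤ)) : ℚ ×ₗ ℤ) : WithTop (ℚ ×ₗ ℤ)) ↔
      ∃ g', g = PowerSeries.C a * g' ∧ (reduction (valRing v) g').order = m := by
  have ha0 : (a : K) ≠ 0 := by
    intro h0
    rw [h0, v.map_zero] at ha
    exact WithTop.coe_ne_top ha.symm
  have hcancel : ∀ {x y : WithTop ℚ}, (μ : WithTop ℚ) + x < μ + y ↔ x < y := fun {x y} =>
    WithTop.add_lt_add_iff_left WithTop.coe_ne_top
  rw [vEta_eq_coe_iff]
  constructor
  · rintro ⟨h1, h2, h3⟩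
    have hdvd : ∀ i, a ∣ PowerSeries.coeff i g := by
      intro i
      have hq : 0 ≤ v (coeffK v g i / a) := by
        have h4 := v.map_mul (a : K) (coeffK v g i / a)
        rw [mul_div_cancel₀ _ ha0, ha] at h4
        have h5 := h2 i
        rw [h4] at h5
        by_contra! hlt
        have h6 := hcancel.2 hlt
        rw [add_zero] at h6
        exact absurd h5 (not_le.2 h6)
      exact ⟨⟨_, hq⟩, Subtype.ext (mul_div_cancel₀ _ ha0).symm⟩
    obtain ⟨g', rfl⟩ := C_dvd_powerSeries_iff.2 hdvd
    have hv : ∀ i, v (coeffK v (PowerSeries.C a * g') i) = μ + v (coeffK v g' i) := by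
      intro i
      rw [coeffK, PowerSeries.coeff_C_mul, ← ha]
      exact v.map_mul _ _
    refine ⟨g', rfl, PowerSeries.order_eq_nat.2 ⟨?_, fun i hi => ?_⟩⟩
    · rw [PowerSeries.coeff_map, Ne, residue_valRing_eq_zero_iff]
      intro h4
      have h5 := hcancel.2 h4
      rw [add_zero] at h5
      rw [hv m] at h1
      exact h5.ne' h1
    · rw [PowerSeries.coeff_map, residue_valRing_eq_zero_iff]
      have h4 := h3 i hi
      rw [hv i] at h4
      exact hcancel.1 (by rwa [add_zero])
  · rintro ⟨g', rfl, hm⟩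
    have hv : ∀ i, v (coeffK v (PowerSeries.C a * g') i) = μ + v (coeffK v g' i) := by
      intro i
      rw [coeffK, PowerSeries.coeff_C_mul, ← ha]
      exact v.map_mul _ _
    have hnn : ∀ i, 0 ≤ v (coeffK v g' i) := fun i => (PowerSeries.coeff i g').2
    obtain ⟨h1, h2⟩ := PowerSeries.order_eq_nat.1 hm
    refine ⟨?_, fun i => ?_, fun i hi => ?_⟩
    · rw [PowerSeries.coeff_map, Ne, residue_valRing_eq_zero_iff, not_lt] at h1
      have h3 : v (coeffK v g' m) = 0 := le_antisymm h1 (hnn m)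
      rw [hv, h3, add_zero]
    · rw [hv]
      exact le_add_of_nonneg_right (hnn i)
    · have h3 := h2 i hi
      rw [PowerSeries.coeff_map, residue_valRing_eq_zero_iff] at h3
      rw [hv]
      have := hcancel.2 h3
      rwa [add_zero] at this

theorem map_pow_eq_coe {x : K} {a : ℚ} (hx : v x = (a : WithTop ℚ)) (n : ℕ) :
    v (x ^ n) = ((n * a : ℚ) : WithTop ℚ) := by
  rw [v.map_pow, hx, ← WithTop.coe_nsmul, nsmul_eq_mul]

theorem exists_isPrimitiveRoot_valRing {p : ℕ} (hp : p.Prime)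
    (hζ : ∃ ζ : K, IsPrimitiveRoot ζ p) : ∃ ζ : valRing v, IsPrimitiveRoot ζ p := by
  obtain ⟨ζ, hζ⟩ := hζ
  obtain ⟨a, ha⟩ := WithTop.ne_top_iff_exists.1
    (mt (AddValuation.top_iff v).1 (hζ.ne_zero hp.ne_zero))
  have h1 := map_pow_eq_coe ha.symm p
  rw [hζ.pow_eq_one, v.map_one] at h1
  have h2 : (p : ℚ) * a = 0 := by exact_mod_cast h1.symm
  have h3 : a = 0 := (mul_eq_zero.1 h2).resolve_left (by exact_mod_cast hp.ne_zero)
  refine ⟨⟨ζ, (mem_valRing v ζ).2 (by rw [← ha, h3]; exact le_rfl)⟩, ?_⟩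
  exact IsPrimitiveRoot.of_map_of_injective (f := (valRing v).subtype) hζ Subtype.val_injective

theorem constEmb_coe (a : valRing v) :
    constEmb v (a : K) = algebraMap (Disk v) (FractionRing (Disk v)) (PowerSeries.C a) :=
  IsFractionRing.lift_algebraMap _ a

/-- `c w = y - h` for `w = (y - h) / c` and `c ∈ R`. -/
theorem C_mul_kummerElt {p : ℕ} {f : Disk v} (h : Disk v) {a : valRing v} (ha : (a : K) ≠ 0) :
    algebraMap (Disk v) (KummerExt v p f) (PowerSeries.C a) * kummerElt v p f h (a : K) =
      kummerRoot v p f - algebraMap (Disk v) (KummerExt v p f) h := by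
  rw [kummerElt, IsScalarTower.algebraMap_apply (Disk v) (FractionRing (Disk v)) (KummerExt v p f),
    ← constEmb_coe, ← Algebra.smul_def, smul_smul, ← map_mul, mul_inv_cancel₀ ha, map_one, one_smul]

/-- Reducedness of the special fibre, as a statement about integral elements. -/
theorem exists_eq_mul_of_hasReducedSpecialFibre [IsDiscreteValuationRing (valRing v)] {p : ℕ}
    {f : Disk v} (hred : HasReducedSpecialFibre v p f) {ϖ : valRing v} (hϖ : Irreducible ϖ)
    {x x' : KummerExt v p f} (hx : IsIntegral (Disk v) x) (hx' : IsIntegral (Disk v) x')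
    (h : x ^ p = algebraMap (Disk v) _ (PowerSeries.C ϖ) * x') :
    ∃ x'', IsIntegral (Disk v) x'' ∧ x = algebraMap (Disk v) _ (PowerSeries.C ϖ) * x'' := by
  let B := normalization v p f
  have hI : (IsLocalRing.maximalIdeal (valRing v)).map (algebraMap (valRing v) B) =
      Ideal.span {algebraMap (Disk v) B (PowerSeries.C ϖ)} := by
    rw [hϖ.maximalIdeal_eq, Ideal.map_span, Set.image_singleton]
    rfl
  have hred' : IsReduced (B ⧸ Ideal.span {algebraMap (Disk v) B (PowerSeries.C ϖ)}) := by
    rw [← hI]; exact hred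
  have h1 : (Ideal.Quotient.mk (Ideal.span {algebraMap (Disk v) B (PowerSeries.C ϖ)})
      (⟨x, hx⟩ : B)) ^ p = 0 := by
    rw [← map_pow, Ideal.Quotient.eq_zero_iff_mem, Ideal.mem_span_singleton]
    exact ⟨⟨x', hx'⟩, Subtype.ext h⟩
  have h2 := hred'.eq_zero _ ⟨p, h1⟩
  rw [Ideal.Quotient.eq_zero_iff_mem, Ideal.mem_span_singleton] at h2
  obtain ⟨y, hy⟩ := h2
  exact ⟨y, y.2, congrArg Subtype.val hy⟩

theorem isOpenDisk_of_ringEquiv {p : ℕ} {f : Disk v}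
    (e : normalization v p f ≃+* PowerSeries (valRing v))
    (he : ∀ r, e (algebraMap (Disk v) _ (PowerSeries.C r)) = PowerSeries.C r) :
    IsOpenDisk v p f :=
  ⟨AlgEquiv.ofRingEquiv (f := e) he⟩

end Valuation

end PCyclic

theorem proposition4p2 (p : ℕ) (hp : p.Prime)
    (K : Type*) [Field K] [CharZero K]
    (v : AddValuation K (WithTop ℚ)) (hvp : v (p : K) = 1)
    [IsDiscreteValuationRing (PCyclic.valRing v)]
    [IsAdicComplete (IsLocalRing.maximalIdeal (PCyclic.valRing v)) (PCyclic.valRing v)]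
    [IsAlgClosed (IsLocalRing.ResidueField (PCyclic.valRing v))]
    (hζ : ∃ ζ : K, IsPrimitiveRoot ζ p)
    (f : PCyclic.Disk v)
    (hf : f - 1 ∈ IsLocalRing.maximalIdeal (PCyclic.Disk v))
    (hfp : ¬ ∃ g : PCyclic.Disk v, g ^ p = f)
    (hred : PCyclic.HasReducedSpecialFibre v p f)
    (hdisk : ¬ PCyclic.IsOpenDisk v p f) :
    ∃ (μ : ℚ) (m : ℤ),
      IsGreatest {x : WithTop (ℚ ×ₗ ℤ) |
          ∃ h : (PCyclic.Disk v)ˣ, x = PCyclic.vEta v (f - (h : PCyclic.Disk v) ^ p)}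
        ((toLex (μ, m) : ℚ ×ₗ ℤ) : WithTop (ℚ ×ₗ ℤ)) ∧
      (0 ≤ μ ∧ μ < (p : ℚ) / ((p : ℚ) - 1) ∧
        ∃ c : K, c ≠ 0 ∧ v c = ((μ / (p : ℚ) : ℚ) : WithTop ℚ)) ∧
      (1 < m ∧ IsCoprime m (p : ℤ)) ∧
      ∀ (c : K) (h : (PCyclic.Disk v)ˣ),
        c ≠ 0 →
        v c = ((μ / (p : ℚ) : ℚ) : WithTop ℚ) →
        PCyclic.vEta v (f - (h : PCyclic.Disk v) ^ p) =
          ((toLex (μ, m) : ℚ ×ₗ ℤ) : WithTop (ℚ ×ₗ ℤ)) →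
        PCyclic.normalization v p f =
          Algebra.adjoin (PCyclic.Disk v) {PCyclic.kummerElt v p f (h : PCyclic.Disk v) c} := by
  classical
  obtain ⟨ζ, hζ⟩ := PCyclic.exists_isPrimitiveRoot_valRing (v := v) hp hζ
  obtain ⟨ϖ, hϖ⟩ := IsDiscreteValuationRing.exists_irreducible (PCyclic.valRing v)
  have hp1 : (1 : ℚ) < p := by exact_mod_cast hp.one_lt
  have hζ1 : ζ - 1 ≠ 0 := sub_ne_zero.2 (hζ.ne_one hp.one_lt)
  obtain ⟨l, hl⟩ := IsDiscreteValuationRing.associated_pow_irreducible hζ1 hϖ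
  -- the valuation `α` of the uniformizer is `1 / (l (p - 1))`
  have hϖK : ((ϖ : PCyclic.valRing v) : K) ≠ 0 := fun h => hϖ.ne_zero (Subtype.ext h)
  obtain ⟨α, hα⟩ := WithTop.ne_top_iff_exists.1 (mt (AddValuation.top_iff v).1 hϖK)
  have hval : (l : ℚ) * (p - 1) * α = 1 := by
    obtain ⟨u, hu⟩ := (PCyclic.associated_natCast_sub_one_pow hp hζ).trans hl.pow_pow
    have h1 := congrArg (fun a : PCyclic.valRing v => v (a : K)) hu
    have hu0 := (PCyclic.isUnit_valRing_iff v (u : PCyclic.valRing v)).1 u.isUnit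
    have h2 : v ((p : K) * ((u : PCyclic.valRing v) : K)) = v (((ϖ : K) ^ l) ^ (p - 1)) := h1
    rw [v.map_mul, hvp, hu0, add_zero, ← pow_mul, PCyclic.map_pow_eq_coe hα.symm] at h2
    have h3 : (1 : ℚ) = ((l * (p - 1) : ℕ) : ℚ) * α := by exact_mod_cast h2
    rw [Nat.cast_mul, Nat.cast_sub hp.one_le, Nat.cast_one] at h3
    exact h3.symm
  have hl0 : (0 : ℚ) < l := by
    refine lt_of_le_of_ne (Nat.cast_nonneg l) fun h0 => ?_
    rw [← h0, zero_mul, zero_mul] at hval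
    exact zero_ne_one hval
  have hlp : (0 : ℚ) < l * (p - 1) := mul_pos hl0 (sub_pos.2 hp1)
  have hα0 : 0 < α := by
    by_contra! h0
    have := mul_nonpos_of_nonneg_of_nonpos hlp.le h0
    rw [hval] at this
    exact absurd this (by norm_num)
  have hpm : ((p : ℕ) : PCyclic.valRing v) ∈ IsLocalRing.maximalIdeal (PCyclic.valRing v) := by
    rw [← IsLocalRing.residue_eq_zero_iff, PCyclic.residue_valRing_eq_zero_iff]
    have : v (((p : ℕ) : PCyclic.valRing v) : K) = 1 := hvp
    rw [this]
    exact zero_lt_one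
  have hfu : IsUnit f := by
    by_contra h
    have h1 := sub_mem ((IsLocalRing.mem_maximalIdeal _).2 h) hf
    rw [sub_sub_cancel] at h1
    exact (IsLocalRing.mem_maximalIdeal _).1 h1 isUnit_one
  obtain ⟨j, m, hjl, hpm', ⟨h₁, g₁, hh₁, hf₁, hg₁⟩, hmax⟩ :=
    PCyclic.exists_best_approximation (F := FractionRing (PCyclic.Disk v)) hp hpm hϖ hζ hl hfu hfp
      fun x x' hx hx' h => PCyclic.exists_eq_mul_of_hasReducedSpecialFibre hred hϖ hx hx' h
  -- `c = ϖ ^ j` witnesses `μ / p ∈ v (K^×)`, for `μ = p j α`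
  obtain ⟨b, hb⟩ := PCyclic.exists_natCast_eq_C_pow_mul hp hζ hl hjl
  have hvpow : ∀ n : ℕ, v ((ϖ ^ n : PCyclic.valRing v) : K) = ((n * α : ℚ) : WithTop ℚ) :=
    fun n => PCyclic.map_pow_eq_coe hα.symm n
  have hp0 : (p : ℚ) ≠ 0 := by exact_mod_cast hp.ne_zero
  have hμp : ((p * j : ℕ) * α : ℚ) / p = j * α := by
    push_cast
    field_simp
  have hb0 : ∀ x : PCyclic.Disk v,
      PCyclic.reduction (PCyclic.valRing v) (PowerSeries.C ϖ * x) = 0 := fun x =>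
    (PCyclic.reduction_eq_zero_iff hϖ).2 (dvd_mul_right _ _)
  have hC0 := (PCyclic.prime_C hϖ).ne_zero
  refine ⟨(p * j : ℕ) * α, m, ⟨⟨hh₁.unit, ?_⟩, ?_⟩, ⟨by positivity, ?_, ?_⟩, ⟨?_, ?_⟩, ?_⟩
  · refine ((PCyclic.vEta_eq_coe_iff_exists (hvpow (p * j)) _ m).2 ⟨g₁, ?_, hg₁⟩).symm
    rw [IsUnit.unit_spec, map_pow, mul_comm p j, pow_mul, sub_eq_iff_eq_add']
    exact hf₁
  · rintro _ ⟨h, rfl⟩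
    have hne : f - (h : PCyclic.Disk v) ^ p ≠ 0 := fun h0 => hfp ⟨h, (sub_eq_zero.1 h0).symm⟩
    obtain ⟨n, g, hg, hg0⟩ := PCyclic.exists_eq_C_pow_mul hϖ hne
    obtain ⟨m', hm'⟩ := ENat.ne_top_iff_exists.1 (mt PowerSeries.order_eq_top.1 hg0)
    rw [(PCyclic.vEta_eq_coe_iff_exists (hvpow n) _ m').2 ⟨g, by rw [map_pow, hg], hm'.symm⟩,
      WithTop.coe_le_coe, Prod.Lex.toLex_le_toLex]
    rcases hmax h g n h.isUnit (sub_eq_iff_eq_add'.1 hg) with hlt | ⟨rfl, hle⟩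
    · left
      exact mul_lt_mul_of_pos_right (by exact_mod_cast hlt) hα0
    · right
      rw [← hm'] at hle
      exact ⟨rfl, Nat.cast_le.2 (ENat.natCast_le_natCast.1 hle)⟩
  · have hjl' : (j : ℚ) < l := by exact_mod_cast hjl
    rw [lt_div_iff₀ (sub_pos.2 hp1)]
    push_cast
    calc (p : ℚ) * j * α * (p - 1) = p * (j * ((p - 1) * α)) := by ring
      _ < p * (l * ((p - 1) * α)) := by
          have := mul_pos (sub_pos.2 hp1) hα0
          gcongr
      _ = p := by rw [← mul_assoc (l : ℚ), hval, mul_one]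
  · exact ⟨(ϖ : K) ^ j, pow_ne_zero _ hϖK, by rw [hμp]; exact hvpow j⟩
  · have hm0 : m ≠ 0 := fun h => hpm' (h ▸ dvd_zero p)
    have hm1 : m ≠ 1 := by
      rintro rfl
      obtain ⟨e, he⟩ := PCyclic.exists_integralClosure_ringEquiv_powerSeries
        (F := FractionRing (PCyclic.Disk v)) hp hϖ hζ hl hfu (pow_ne_zero j hC0) hb (hb0 b) hf₁ hg₁
      exact hdisk (PCyclic.isOpenDisk_of_ringEquiv e he)
    omega
  · exact Nat.isCoprime_iff_coprime.2 ((Nat.Prime.coprime_iff_not_dvd hp).2 hpm').symm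
  · intro c h hc0 hc hvE
    rw [hμp] at hc
    obtain ⟨a, rfl⟩ : ∃ a : PCyclic.valRing v, (a : K) = c :=
      ⟨⟨c, (PCyclic.mem_valRing v c).2 (by rw [hc]; exact_mod_cast (by positivity))⟩, rfl⟩
    have ha0 : a ≠ 0 := fun h0 => hc0 (by rw [h0]; rfl)
    have hap : v ((a ^ p : PCyclic.valRing v) : K) = (((p * j : ℕ) * α : ℚ) : WithTop ℚ) := by
      refine (PCyclic.map_pow_eq_coe hc p).trans ?_
      push_cast
      rw [mul_assoc]
    obtain ⟨g, hg, hgm⟩ := (PCyclic.vEta_eq_coe_iff_exists hap _ m).1 hvE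
    -- `a` is a unit times `ϖ ^ j`, so `p / a ^ (p - 1)` is still divisible by `ϖ`
    obtain ⟨i, hi⟩ := IsDiscreteValuationRing.associated_pow_irreducible ha0 hϖ
    obtain ⟨u, hu⟩ := hi
    have hij : i = j := by
      have h1 := congrArg (fun a : PCyclic.valRing v => v (a : K)) hu
      have hu0 := (PCyclic.isUnit_valRing_iff v (u : PCyclic.valRing v)).1 u.isUnit
      have h2 : v ((a : K) * ((u : PCyclic.valRing v) : K)) = _ := h1.trans (hvpow i)
      rw [v.map_mul, hu0, add_zero, hc, WithTop.coe_inj] at h2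
      exact_mod_cast (mul_right_cancel₀ hα0.ne' h2).symm
    subst hij
    refine PCyclic.integralClosure_eq_adjoin_of_order hp hϖ hζ hl hfu (c := PowerSeries.C a)
      (b := PowerSeries.C ϖ * (PowerSeries.C (u : PCyclic.valRing v) ^ (p - 1) * b)) (g := g)
      (fun h0 => ha0 (PowerSeries.C_injective (h0.trans (map_zero _).symm))) ?_ (hb0 _) ?_ hgm hpm'
      (PCyclic.C_mul_kummerElt _ hc0)
    · rw [hb, ← map_pow, ← hu, map_mul]
      ring
    · rw [← map_pow]
      exact sub_eq_iff_eq_add'.1 hg
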